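/- Conventions. A threshold gate with $k$ input wires $y_1,\dots,y_k\in\{0,1\}$, weights $w\in\mathbb R^k$ and threshold $t\in\mathbb R$ outputs $1$ iff $\sum_{i} w_i y_i\ge t$; it is a majority gate if all $w_i=1$ ($t$ is arbitrary). An $\mathsf{LT}_d$ circuit on $n$ Boolean variables is a circuit of $d$ layers of threshold gates with a single output gate in the top layer, in which the gates of the bottom layer read literals $x_i,\neg x_i$ and the gates of each other layer read gates of the layer directly below. Fan-out is unbounded and a gate may read the same bit through several wires. An $\widehat{\mathsf{LT}}_d$ circuit is an $\mathsf{LT}_d$ circuit all of whose gates are majority gates. The size of a circuit is its number of gates plus its number of wires. A $\mathsf{DISJOR}\circ\widehat{\mathsf{LT}}_d$ circuit is an OR of $\widehat{\mathsf{LT}}_d$ circuits such that on every input at most one of them outputs $1$; its top fan-in is the number of these circuits. Statement. For every constant $d\ge 2$ there is a constant $c>0$, depending only on $d$, such that the following holds. Let $s:\mathbb N\to\mathbb N$ be a size parameter with $s(n)=2^{o(n)}$. Then for every $n\ge 1$ and every real $\varepsilon\in\left(\frac{\log_2 s(n)}{n},1\right)$, every $\mathsf{LT}_d$ circuit on $n$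 variables of size at most $s(n)$ is equivalent to (computes the same function as) a $\mathsf{DISJOR}\circ\widehat{\mathsf{LT}}_d$ circuit such that 1. the top $\mathsf{DISJOR}$ gate has fan-in at most $2^{c\,\varepsilon n}$ (that is, $2^{O(\varepsilon n)}$); 2. each $\widehat{\mathsf{LT}}_d$ subcircuit has size at most $c\cdot s(n)^{c/\varepsilon}$ (that is, $O(s^{O(1/\varepsilon)})$). -/

import Mathlib

open Filter Asymptotics

/-- A threshold gate reading bits indexed by `α`. The source map need not be injective: an input
may be wired to the gate several times, and every wire counts in the fan-in. -/
structure ThrGate (α : Type) where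
  fanIn : ℕ
  source : Fin fanIn → α
  weight : Fin fanIn → ℝ
  threshold : ℝ

namespace ThrGate

/-- The gate outputs `true` iff the weighted sum of its inputs is at least its threshold. -/
noncomputable def eval {α : Type} (g : ThrGate α) (v : α → Bool) : Bool :=
  decide (g.threshold ≤ ∑ i, if v (g.source i) then g.weight i else 0)

/-- A majority gate: all weights are `1` (the threshold is arbitrary). -/
def IsMaj {α : Type} (g : ThrGate α) : Prop := ∀ i, g.weight i = 1

end ThrGate

/-- The literals in `n` variables: `(i, true)` is `xᵢ` and `(i, false)` is `¬ xᵢ`. -/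
abbrev Lit (n : ℕ) : Type := Fin n × Bool

/-- The value of a literal on an input. -/
def Lit.eval {n : ℕ} (x : Fin n → Bool) (l : Lit n) : Bool := x l.1 == l.2

/-- Layered circuits of threshold gates on `n` variables, of the given depth (first index) and
with the given number of output gates (second index). Gates of the bottom layer read literals,
those of every later layer read the gates of the layer directly below; fan-out is unbounded. -/
inductive ThrLayers (n : ℕ) : ℕ → ℕ → Type
  | bottom {w : ℕ} (g : Fin w → ThrGate (Lit n)) : ThrLayers n 1 w
  | layer {d v w : ℕ} (C : ThrLayers n d v) (g : Fin w → ThrGate (Fin v)) : ThrLayers n (d + 1) w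

namespace ThrLayers

/-- The outputs of the last layer. -/
noncomputable def eval {n : ℕ} : {d w : ℕ} → ThrLayers n d w → (Fin n → Bool) → Fin w → Bool
  | _, _, bottom g, x => fun j => (g j).eval (Lit.eval x)
  | _, _, layer C g, x => fun j => (g j).eval (C.eval x)

/-- The size: the number of gates plus the number of wires. -/
def size {n : ℕ} : {d w : ℕ} → ThrLayers n d w → ℕ
  | _, _, bottom g => ∑ j, (1 + (g j).fanIn)
  | _, _, layer C g => C.size + ∑ j, (1 + (g j).fanIn)

/-- Every gate is a majority gate. -/
def IsMaj {n : ℕ} : {d w : ℕ} → ThrLayers n d w → Prop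
  | _, _, bottom g => ∀ j, (g j).IsMaj
  | _, _, layer C g => C.IsMaj ∧ ∀ j, (g j).IsMaj

end ThrLayers

/-- Depth-`d` threshold circuits on `n` variables: layered circuits with one output gate. -/
abbrev LTCircuit (n d : ℕ) : Type := ThrLayers n d 1

/-- The Boolean function computed by a threshold circuit. -/
noncomputable def LTCircuit.fn {n d : ℕ} (C : LTCircuit n d) (x : Fin n → Bool) : Bool := C.eval x 0

/-- Depth-`d` majority circuits on `n` variables. -/
abbrev HLTCircuit (n d : ℕ) : Type := {C : LTCircuit n d // C.IsMaj}

/-- A disjoint OR of depth-`d` majority circuits: on every input at most one of the subcircuits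
outputs `true`. -/
structure DisjOrHLT (n d : ℕ) where
  fanIn : ℕ
  sub : Fin fanIn → HLTCircuit n d
  disjoint : ∀ (x : Fin n → Bool) (i j : Fin fanIn),
    LTCircuit.fn (sub i).1 x = true → LTCircuit.fn (sub j).1 x = true → i = j

/-- The Boolean function computed by a disjoint OR of majority circuits. -/
noncomputable def DisjOrHLT.fn {n d : ℕ} (D : DisjOrHLT n d) (x : Fin n → Bool) : Bool :=
  decide (∃ i, LTCircuit.fn (D.sub i).1 x = true)

/-! The output gate is split into a disjoint sum of majorities, and the layers below are then
brought to small weights without adding depth.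

Integer weights with polynomially many bits suffice for a threshold gate (`exists_int_weights`), and
telescoping over those bits writes its indicator as a sum of polynomially many exact indicators `[L
= 0]` (`ThrOf.exists_eqOf_sum`). At the output gate, `L` takes at most `2 ^ min(n, s)` values, and
each nonzero value has few prime divisors. Counting therefore gives `m ≈ εn / log s` primes of size
`s ^ O(1/ε)` such that `L = 0` whenever all of them divide `L`. Modulo a prime `q`, `L` agrees with
a form `F` with small coefficients, and `q ∣ L` says that `F` is one of `k + 1` multiples of `q`.
Guessing the multiple for every prime gives `(k + 1) ^ m ≤ s ^ m = 2 ^ O(εn)` mutually exclusive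
cases. Each case is a conjunction of small equalities, that is, one inequality "sum of squares `≤
0`" (`EqOf.exists_majOf_sum`).

The squares multiply pairs of second-layer gates. This costs no depth, because exact gates are
closed under conjunction and so a product of two thresholds is a short combination of thresholds on
the same layer (`ThrOf.comb_mul`). What is left is a majority of threshold gates. The fraction of
primes of a large set that divide `L` approximates `[L = 0]`, so every threshold gate is uniformly
close to a small-weight combination of majorities, closely enough not to disturb the majority above
it (`MajOf.thrOf_subset`). Repeating this downwards (`majOf_thrIter_subset`) reaches the literals.
-/

section

/-! ### Indicators and integer combinations of bounded total weight -/

/-- The integer indicator of a bit. -/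
def ind (b : Bool) : ℤ := if b then 1 else 0

theorem ind_nonneg (b : Bool) : 0 ≤ ind b := by cases b <;> simp [ind]

theorem ind_le_one (b : Bool) : ind b ≤ 1 := by cases b <;> simp [ind]

theorem ind_not (b : Bool) : ind (!b) = 1 - ind b := by cases b <;> simp [ind]

theorem ind_and (a b : Bool) : ind (a && b) = ind a * ind b := by
  cases a <;> cases b <;> simp [ind]

theorem ind_decide (p : Prop) [Decidable p] : ind (decide p) = if p then 1 else 0 := by
  simp [ind]

theorem ind_eq_one {b : Bool} : ind b = 1 ↔ b = true := by cases b <;> simp [ind]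

variable {X : Type}

/-- `Comb G W F`: the function `F` is an integer combination of `1` and of indicators of functions
in `G` whose coefficients have absolute values summing to at most `W`. -/
inductive Comb (G : Set (X → Bool)) : ℕ → (X → ℤ) → Prop
  | zero : Comb G 0 (fun _ => 0)
  | one : Comb G 1 (fun _ => 1)
  | ind {g : X → Bool} (hg : g ∈ G) : Comb G 1 (fun x => ind (g x))
  | neg {W : ℕ} {F : X → ℤ} (h : Comb G W F) : Comb G W (fun x => -F x)
  | add {W W' : ℕ} {F F' : X → ℤ} (h : Comb G W F) (h' : Comb G W' F') :
      Comb G (W + W') (fun x => F x + F' x)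
  | mono {W W' : ℕ} {F : X → ℤ} (h : Comb G W F) (hW : W ≤ W') : Comb G W' F

/-- A family of functions closed under complement. -/
def ComplClosed (G : Set (X → Bool)) : Prop := ∀ g ∈ G, (fun x => !g x) ∈ G

namespace Comb

variable {G H : Set (X → Bool)}

theorem congr {W W' : ℕ} {F F' : X → ℤ} (h : Comb G W F) (hW : W = W') (hF : ∀ x, F x = F' x) :
    Comb G W' F' := by
  obtain rfl : F = F' := funext hF
  exact hW ▸ h

theorem sub {W W' : ℕ} {F F' : X → ℤ} (h : Comb G W F) (h' : Comb G W' F') :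
    Comb G (W + W') (fun x => F x - F' x) :=
  (h.add h'.neg).congr rfl fun x => by ring

theorem sum {ι : Type*} (s : Finset ι) {W : ℕ} {F : ι → X → ℤ}
    (h : ∀ i ∈ s, Comb G W (F i)) : Comb G (s.card * W) (fun x => ∑ i ∈ s, F i x) := by
  classical
  induction s using Finset.induction_on with
  | empty => exact Comb.zero.congr (by simp) (by simp)
  | insert a s ha ih =>
    refine ((h a (Finset.mem_insert_self _ _)).add
      (ih fun i hi => h i (Finset.mem_insert_of_mem hi))).congr ?_ fun x => ?_
    · rw [Finset.card_insert_of_notMem ha]; ring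
    · rw [Finset.sum_insert ha]

theorem smul (c : ℤ) {W : ℕ} {F : X → ℤ} (h : Comb G W F) :
    Comb G (c.natAbs * W) (fun x => c * F x) := by
  have key : ∀ m : ℕ, Comb G (m * W) (fun x => (m : ℤ) * F x) := fun m =>
    (Comb.sum (Finset.range m) fun _ _ => h).congr (by simp) (by simp)
  rcases Int.natAbs_eq c with hc | hc
  · exact (key c.natAbs).congr rfl fun x => by rw [← hc]
  · exact (key c.natAbs).neg.congr rfl fun x => by
      nth_rewrite 2 [hc]; ring

theorem const (c : ℤ) : Comb G c.natAbs (fun _ => c) :=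
  (Comb.one.smul c).congr (by simp) (by simp)

theorem bind {V : ℕ} (hV : 1 ≤ V) (hG : ∀ g ∈ G, Comb H V (fun x => _root_.ind (g x)))
    {W : ℕ} {F : X → ℤ} (h : Comb G W F) : Comb H (W * V) F := by
  induction h with
  | zero => exact Comb.zero.mono (by simp)
  | one => exact Comb.one.mono (by simpa)
  | ind hg => exact (hG _ hg).mono (by simp)
  | neg _ ih => exact ih.neg
  | add _ _ ih ih' => exact (ih.add ih').congr (by ring) fun _ => rfl
  | mono _ hW ih => exact ih.mono (Nat.mul_le_mul_right _ hW)

theorem mono_set (hGH : G ⊆ H) {W : ℕ} {F : X → ℤ} (h : Comb G W F) : Comb H W F :=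
  (h.bind (H := H) le_rfl fun _ hg => Comb.ind (hGH hg)).congr (by simp) fun _ => rfl

/-- Expand by bilinearity. Besides the pairwise products, the constant term of either factor leaves
single indicators and constants, which is why `hG` and `hV` appear. -/
theorem mul {V : ℕ} (hV : 1 ≤ V) (hG : ∀ g ∈ G, Comb H V (fun x => _root_.ind (g x)))
    (hGG : ∀ g ∈ G, ∀ g' ∈ G, Comb H V (fun x => _root_.ind (g x) * _root_.ind (g' x)))
    {W W' : ℕ} {F F' : X → ℤ} (h : Comb G W F) (h' : Comb G W' F') :
    Comb H (W * W' * V) (fun x => F x * F' x) := by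
  have key : ∀ g ∈ G, ∀ {W' : ℕ} {F' : X → ℤ}, Comb G W' F' →
      Comb H (W' * V) (fun x => _root_.ind (g x) * F' x) := by
    intro g hg W' F' h'
    induction h' with
    | zero => exact Comb.zero.congr (by simp) (by simp)
    | one => exact (hG g hg).congr (by simp) (by simp)
    | ind hg' => exact (hGG g hg _ hg').congr (by simp) fun _ => rfl
    | neg _ ih => exact ih.neg.congr rfl fun _ => by ring
    | add _ _ ih ih' => exact (ih.add ih').congr (by ring) fun _ => by ring
    | mono _ hW ih => exact ih.mono (Nat.mul_le_mul_right _ hW)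
  induction h with
  | zero => exact Comb.zero.congr (by simp) (by simp)
  | one => exact (h'.bind hV hG).congr (by simp) (by simp)
  | ind hg => exact (key _ hg h').congr (by ring) fun _ => rfl
  | neg _ ih => exact ih.neg.congr rfl fun _ => by ring
  | add _ _ ih ih' => exact (ih.add ih').congr (by ring) fun _ => by ring
  | mono _ hW ih => exact ih.mono (by gcongr)

/-- Negative coefficients disappear through `-[g] = [¬g] - 1`, at the price of a constant that a
gate can move into its threshold. -/
theorem exists_list (hG : ComplClosed G) {W : ℕ} {F : X → ℤ} (h : Comb G W F) :
    ∃ (l : List (X → Bool)) (c : ℤ), l.length ≤ W ∧ (∀ g ∈ l, g ∈ G) ∧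
      ∀ x, F x = c + (l.map fun g => _root_.ind (g x)).sum := by
  induction h with
  | zero => exact ⟨[], 0, by simp, by simp, by simp⟩
  | one => exact ⟨[], 1, by simp, by simp, by simp⟩
  | @ind g hg => exact ⟨[g], 0, by simp, by simpa using hg, by simp⟩
  | neg _ ih =>
    obtain ⟨l, c, hl, hlG, hF⟩ := ih
    refine ⟨l.map fun g x => !g x, -c - l.length, by simpa using hl, ?_, fun x => ?_⟩
    · intro g hg
      obtain ⟨g', hg', rfl⟩ := List.mem_map.1 hg
      exact hG _ (hlG _ hg')
    · simp only [hF x, List.map_map]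
      have : ∀ l : List (X → Bool),
          (l.map ((fun g => _root_.ind (g x)) ∘ fun g x => !g x)).sum
            = l.length - (l.map fun g => _root_.ind (g x)).sum := by
        intro l
        induction l with
        | nil => simp
        | cons a l ih => simp [ih, ind_not]; ring
      rw [this]; ring
  | add _ _ ih ih' =>
    obtain ⟨l, c, hl, hlG, hF⟩ := ih
    obtain ⟨l', c', hl', hlG', hF'⟩ := ih'
    refine ⟨l ++ l', c + c', by simp; omega, fun g hg => ?_, fun x => ?_⟩
    · rcases List.mem_append.1 hg with h | h
      exacts [hlG g h, hlG' g h]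
    · simp only [hF, hF', List.map_append, List.sum_append]; ring
  | mono _ hW ih =>
    obtain ⟨l, c, hl, h⟩ := ih
    exact ⟨l, c, hl.trans hW, h⟩

end Comb

/-! ### Classes of majority, threshold and exact threshold gates -/

/-- Majority gates of total weight at most `W` reading functions in `G`. -/
def MajOf (W : ℕ) (G : Set (X → Bool)) : Set (X → Bool) :=
  {f | ∃ (F : X → ℤ) (c : ℤ), Comb G W F ∧ ∀ x, f x = decide (c ≤ F x)}

/-- Integer affine forms in at most `k` functions in `G`. -/
def LinOf (k : ℕ) (G : Set (X → Bool)) : Set (X → ℤ) :=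
  {L | ∃ (ι : Type) (_ : Fintype ι) (g : ι → X → Bool) (v : ι → ℤ) (c : ℤ),
    Fintype.card ι ≤ k ∧ (∀ i, g i ∈ G) ∧ ∀ x, L x = c + ∑ i, v i * ind (g i x)}

/-- Threshold gates with at most `k` inputs reading functions in `G`. -/
def ThrOf (k : ℕ) (G : Set (X → Bool)) : Set (X → Bool) :=
  {f | ∃ L ∈ LinOf k G, ∀ x, f x = decide (0 ≤ L x)}

/-- Exact threshold gates with at most `k` inputs reading functions in `G`, given by affine forms
with values of absolute value less than `2 ^ B`. -/
def EqOf (k B : ℕ) (G : Set (X → Bool)) : Set (X → Bool) :=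
  {f | ∃ L ∈ LinOf k G, (∀ x, |L x| < 2 ^ B) ∧ ∀ x, f x = decide (L x = 0)}

variable {G H : Set (X → Bool)}

theorem MajOf.mono {W W' : ℕ} (hW : W ≤ W') (hG : G ⊆ H) : MajOf W G ⊆ MajOf W' H := by
  rintro f ⟨F, c, hF, hf⟩
  exact ⟨F, c, (hF.mono hW).mono_set hG, hf⟩

theorem LinOf.mono {k k' : ℕ} (hk : k ≤ k') (hG : G ⊆ H) : LinOf k G ⊆ LinOf k' H := by
  rintro L ⟨ι, _, g, v, c, hι, hg, hL⟩
  exact ⟨ι, _, g, v, c, hι.trans hk, fun i => hG (hg i), hL⟩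

theorem ThrOf.mono {k k' : ℕ} (hk : k ≤ k') (hG : G ⊆ H) : ThrOf k G ⊆ ThrOf k' H := by
  rintro f ⟨L, hL, hf⟩
  exact ⟨L, LinOf.mono hk hG hL, hf⟩

theorem MajOf.complClosed (W : ℕ) (G : Set (X → Bool)) : ComplClosed (MajOf W G) := by
  rintro f ⟨F, c, hF, hf⟩
  refine ⟨_, 1 - c, hF.neg, fun x => ?_⟩
  simp only [hf x]
  rw [← decide_not]
  exact decide_eq_decide.2 (by omega)

theorem LinOf.const (k : ℕ) (G : Set (X → Bool)) (c : ℤ) : (fun _ => c) ∈ LinOf k G :=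
  ⟨Empty, inferInstance, Empty.elim, Empty.elim, c, by simp, by simp, by simp⟩

theorem LinOf.smul_add {k k' : ℕ} {L L' : X → ℤ} (a : ℤ) (h : L ∈ LinOf k G)
    (h' : L' ∈ LinOf k' G) : (fun x => a * L x + L' x) ∈ LinOf (k + k') G := by
  obtain ⟨ι, _, g, v, c, hι, hg, hL⟩ := h
  obtain ⟨ι', _, g', v', c', hι', hg', hL'⟩ := h'
  refine ⟨ι ⊕ ι', inferInstance, Sum.elim g g', Sum.elim (fun i => a * v i) v', a * c + c',
    by rw [Fintype.card_sum]; omega, ?_, fun x => ?_⟩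
  · rintro (i | i)
    exacts [hg i, hg' i]
  · simp only [hL, hL', Fintype.sum_sum_type, Sum.elim_inl, Sum.elim_inr, mul_add, Finset.mul_sum, mul_assoc]
    ring

theorem LinOf.add_const {k : ℕ} {L : X → ℤ} (a b : ℤ) (h : L ∈ LinOf k G) :
    (fun x => a * L x + b) ∈ LinOf k G :=
  LinOf.smul_add (k' := 0) a h (LinOf.const 0 G b)

theorem ThrOf.complClosed (k : ℕ) (G : Set (X → Bool)) : ComplClosed (ThrOf k G) := by
  rintro f ⟨L, hL, hf⟩
  refine ⟨_, LinOf.add_const (-1) (-1) hL, fun x => ?_⟩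
  simp only [hf x]
  rw [← decide_not]
  exact decide_eq_decide.2 (by omega)

/-- Two forms are packed as `2 ^ B' * L + L'`. As `|L'| < 2 ^ B'`, the two parts cannot cancel
unless both vanish. -/
theorem EqOf.and {k k' B B' : ℕ} {f f' : X → Bool} (h : f ∈ EqOf k B G) (h' : f' ∈ EqOf k' B' G) :
    (fun x => f x && f' x) ∈ EqOf (k + k') (B + B' + 1) G := by
  obtain ⟨L, hL, hB, hf⟩ := h
  obtain ⟨L', hL', hB', hf'⟩ := h'
  refine ⟨_, LinOf.smul_add (2 ^ B') hL hL', fun x => ?_, fun x => ?_⟩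
  · have h1 := hB x
    have h2 := hB' x
    rw [abs_lt] at h1 h2 ⊢
    have h3 : (0 : ℤ) < 2 ^ B' := by positivity
    have h4 : (1 : ℤ) ≤ 2 ^ B := one_le_pow₀ (by norm_num)
    rw [pow_succ, pow_add]
    constructor <;> nlinarith
  · simp only [hf, hf']
    rw [← Bool.decide_and]
    refine decide_eq_decide.2 ⟨fun ⟨h1, h2⟩ => by simp [h1, h2], fun h => ?_⟩
    have h2 := hB' x
    have h0 : L' x = 0 := by
      refine Int.eq_zero_of_abs_lt_dvd ?_ h2
      exact ⟨-L x, by linarith⟩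
    refine ⟨?_, h0⟩
    have h3 : (0 : ℤ) < 2 ^ B' := by positivity
    rw [h0, add_zero] at h
    exact (mul_eq_zero.1 h).resolve_left h3.ne'

/-- `[L = 0] = [L ≥ 0] + [-L ≥ 0] - 1`. -/
theorem EqOf.comb_thrOf {k B : ℕ} {f : X → Bool} (h : f ∈ EqOf k B G) :
    Comb (ThrOf k G) 3 (fun x => ind (f x)) := by
  obtain ⟨L, hL, -, hf⟩ := h
  have h1 : (fun x => decide (0 ≤ 1 * L x + 0)) ∈ ThrOf k G := ⟨_, LinOf.add_const 1 0 hL, fun x => rfl⟩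
  have h2 : (fun x => decide (0 ≤ -1 * L x + 0)) ∈ ThrOf k G :=
    ⟨_, LinOf.add_const (-1) 0 hL, fun x => rfl⟩
  refine (((Comb.ind h1).add (Comb.ind h2)).sub Comb.one).congr rfl fun x => ?_
  rw [hf]
  simp only [ind_decide]
  split_ifs <;> omega

theorem LinOf.ncard_range_le {k : ℕ} {L : X → ℤ} (h : L ∈ LinOf k G) :
    (Set.range L).Finite ∧ (Set.range L).ncard ≤ 2 ^ k := by
  classical
  obtain ⟨ι, _, g, v, c, hι, hg, hL⟩ := h
  have hsub : Set.range L ⊆ Set.range fun y : ι → Bool => c + ∑ i, v i * ind (y i) := by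
    rintro _ ⟨x, rfl⟩
    exact ⟨fun i => g i x, (hL x).symm⟩
  refine ⟨(Set.finite_range _).subset hsub, ?_⟩
  refine (Set.ncard_le_ncard hsub (Set.finite_range _)).trans ?_
  rw [← Set.image_univ]
  refine (Set.ncard_image_le Set.finite_univ).trans ?_
  rw [Set.ncard_univ, Nat.card_eq_fintype_card, Fintype.card_fun, Fintype.card_bool]
  exact Nat.pow_le_pow_right (by norm_num) hι

end

/-! ### Integer weights with polynomially many bits -/

/-- Dirichlet's pigeonhole: two of the first `N ^ k + 1` multiples of `w` have fractional parts in
the same box of side `1 / N`, and `q` is the difference of their indices. -/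
theorem exists_simultaneous_approx {ι : Type*} [Fintype ι] (w : ι → ℝ) {N : ℕ} (hN : 0 < N) :
    ∃ q : ℕ, 0 < q ∧ q ≤ N ^ Fintype.card ι ∧
      ∀ i, |(q : ℝ) * w i - round ((q : ℝ) * w i)| ≤ 1 / N := by
  classical
  have hNR : (0 : ℝ) < N := by exact_mod_cast hN
  let f : Fin (N ^ Fintype.card ι + 1) → ι → Fin N := fun q i =>
    ⟨⌊(N : ℝ) * Int.fract ((q : ℕ) * w i : ℝ)⌋₊, by
      rw [Nat.floor_lt (mul_nonneg hNR.le (Int.fract_nonneg _))]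
      nlinarith [Int.fract_lt_one ((q : ℕ) * w i : ℝ)]⟩
  obtain ⟨a, b, hab, hf⟩ : ∃ a b, a < b ∧ f a = f b := by
    obtain ⟨a, b, hne, h⟩ := Fintype.exists_ne_map_eq_of_card_lt f (by simp)
    rcases lt_or_gt_of_ne hne with h' | h'
    · exact ⟨a, b, h', h⟩
    · exact ⟨b, a, h', h.symm⟩
  have hab' : (a : ℕ) < b := hab
  refine ⟨b - a, by omega, by have := b.2; omega, fun i => ?_⟩
  refine (round_le _ (⌊((b : ℕ) : ℝ) * w i⌋ - ⌊((a : ℕ) : ℝ) * w i⌋)).trans ?_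
  have hfi : ⌊(N : ℝ) * Int.fract ((a : ℕ) * w i : ℝ)⌋₊
      = ⌊(N : ℝ) * Int.fract ((b : ℕ) * w i : ℝ)⌋₊ := congrArg Fin.val (congrFun hf i)
  have ha := Nat.floor_le (mul_nonneg hNR.le (Int.fract_nonneg ((a : ℕ) * w i : ℝ)))
  have hb := Nat.floor_le (mul_nonneg hNR.le (Int.fract_nonneg ((b : ℕ) * w i : ℝ)))
  have ha' := Nat.lt_floor_add_one ((N : ℝ) * Int.fract ((a : ℕ) * w i : ℝ))
  have hb' := Nat.lt_floor_add_one ((N : ℝ) * Int.fract ((b : ℕ) * w i : ℝ))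
  rw [hfi] at ha ha'
  have e1 := Int.floor_add_fract (((a : ℕ) : ℝ) * w i)
  have e2 := Int.floor_add_fract (((b : ℕ) : ℝ) * w i)
  rw [Nat.cast_sub hab'.le, le_div_iff₀ hNR]
  refine (congrArg _ (Nat.abs_cast N).symm).trans_le ?_
  rw [← abs_mul]
  push_cast
  rw [abs_le]
  constructor <;> nlinarith

theorem abs_sum_mul_le {ι : Type*} [Fintype ι] {v y : ι → ℤ} {M : ℤ}
    (hv : ∀ i, |v i| ≤ M) (hy : ∀ i, |y i| ≤ 1) :
    |∑ i, v i * y i| ≤ Fintype.card ι * M := by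
  refine (Finset.abs_sum_le_sum_abs _ _).trans ?_
  calc ∑ i, |v i * y i| ≤ ∑ _i : ι, M := Finset.sum_le_sum fun i _ => by
        rw [abs_mul]
        nlinarith [hv i, hy i, abs_nonneg (v i), abs_nonneg (y i)]
    _ = _ := by simp

/-- Scale the largest weight to `±1` and write `q * u = p + w'` with `p` integral and `w'` small.
The remainder vanishes where the weight was largest, so its support shrinks and induction applies.
Since `∑ w' y` stays below `1` in absolute value, the sign is decided by `∑ p y`, with ties broken
by `w'`. -/
theorem exists_int_weights_of_support {ι : Type*} [Fintype ι] (r : ℕ) :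
    ∀ w : ι → ℝ, (Finset.univ.filter fun i => w i ≠ 0).card ≤ r →
      ∃ v : ι → ℤ,
        (∀ i, |v i| ≤ (((Fintype.card ι : ℤ) + 2) ^ (Fintype.card ι + 1)) ^ r) ∧
        ∀ y : ι → ℤ, (∀ i, |y i| ≤ 1) → (0 ≤ ∑ i, w i * y i ↔ 0 ≤ ∑ i, v i * y i) := by
  classical
  induction r with
  | zero =>
    intro w hw
    have hw0 : ∀ i, w i = 0 := by simpa [Finset.filter_eq_empty_iff] using hw
    exact ⟨0, by simp, by simp [hw0]⟩
  | succ r ih =>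
    intro w hw
    set k := Fintype.card ι with hk
    set C : ℤ := ((k : ℤ) + 2) ^ (k + 1) with hC
    have hCpos : 1 ≤ C := one_le_pow₀ (by omega)
    by_cases hz : ∀ i, w i = 0
    · exact ⟨0, fun i => by simpa using pow_nonneg (by omega) _, by simp [hz]⟩
    push Not at hz
    obtain ⟨j, hj⟩ := hz
    have : Nonempty ι := ⟨j⟩
    obtain ⟨i₀, hi₀⟩ := Finite.exists_max fun i => |w i|
    have hpos : 0 < |w i₀| := (abs_pos.2 hj).trans_le (hi₀ j)
    set u : ι → ℝ := fun i => w i / |w i₀| with hu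
    have hu1 : ∀ i, |u i| ≤ 1 := fun i => by
      rw [hu]; simp only [abs_div, abs_abs]; exact (div_le_one hpos).2 (hi₀ i)
    -- Denominator `k + 1` makes the `k` errors add up to at most `k / (k + 1) < 1`.
    obtain ⟨q, hq0, hqle, hq⟩ := exists_simultaneous_approx u (Nat.succ_pos k)
    set p : ι → ℤ := fun i => round ((q : ℝ) * u i) with hp
    set w' : ι → ℝ := fun i => q * u i - p i with hw'
    have hw'0 : w' i₀ = 0 := by
      rcases abs_cases (w i₀) with ⟨h, -⟩ | ⟨h, -⟩
      · have : u i₀ = 1 := by simp only [hu, h]; exact div_self (by rw [← h]; exact hpos.ne')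
        simp [hw', hp, this]
      · have h0 : w i₀ ≠ 0 := abs_pos.1 hpos
        have : u i₀ = -1 := by simp only [hu, h, div_neg, div_self h0]
        have hr : round (-(q : ℝ)) = -(q : ℤ) := by
          have := round_intCast (α := ℝ) (-(q : ℤ))
          push_cast at this; exact this
        simp [hw', hp, this, hr]
    have hcard : (Finset.univ.filter fun i => w' i ≠ 0).card ≤ r := by
      have hss : (Finset.univ.filter fun i => w' i ≠ 0)
          ⊆ (Finset.univ.filter fun i => w i ≠ 0).erase i₀ := by
        intro i hi
        simp only [Finset.mem_filter, Finset.mem_univ, true_and, Finset.mem_erase] at hi ⊢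
        refine ⟨fun h => hi (h ▸ hw'0), fun h => hi ?_⟩
        simp [hw', hp, hu, h]
      have := Finset.card_le_card hss
      rw [Finset.card_erase_of_mem (by simpa using abs_pos.1 hpos)] at this
      omega
    obtain ⟨v', hv', hs'⟩ := ih w' hcard
    -- `M` exceeds every `|∑ v' y|`, so `M * p + v'` realises the lexicographic comparison.
    set M : ℤ := k * C ^ r + 1 with hM
    have hCr : 1 ≤ C ^ r := one_le_pow₀ hCpos
    refine ⟨fun i => M * p i + v' i, fun i => ?_, fun y hy => ?_⟩
    · have hpq : |p i| ≤ q := by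
        have h1 := abs_sub_round ((q : ℝ) * u i)
        have h2 : |(q : ℝ) * u i| ≤ q := by
          rw [abs_mul, Nat.abs_cast]; exact mul_le_of_le_one_right (Nat.cast_nonneg _) (hu1 i)
        have h3 : |(p i : ℝ)| < q + 1 := by
          rw [abs_lt]; rw [abs_le] at h1 h2; constructor <;> simp only [hp] <;> linarith
        have h4 : |p i| < q + 1 := by exact_mod_cast h3
        omega
      have hqC : (q : ℤ) ≤ ((k : ℤ) + 1) ^ k := by exact_mod_cast hqle
      have hC' : (k + 1) * ((k : ℤ) + 1) ^ k + 1 ≤ C := by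
        have h1 : ((k : ℤ) + 1) ^ k ≤ (k + 2) ^ k := pow_le_pow_left₀ (by omega) (by omega) _
        have h2 : 1 ≤ ((k : ℤ) + 2) ^ k := one_le_pow₀ (by omega)
        rw [hC, pow_succ]; nlinarith
      have hk0 : (0 : ℤ) ≤ k := by omega
      have hB : (0 : ℤ) ≤ ((k : ℤ) + 1) ^ k := by positivity
      calc |M * p i + v' i| ≤ M * |p i| + |v' i| := by
            refine (abs_add_le _ _).trans ?_
            rw [abs_mul, abs_of_nonneg (by positivity : (0 : ℤ) ≤ M)]
        _ ≤ (k + 1) * C ^ r * ((k : ℤ) + 1) ^ k + C ^ r :=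
            add_le_add (mul_le_mul (by rw [hM]; linarith) (hpq.trans hqC) (abs_nonneg _)
              (by positivity)) (hv' i)
        _ = C ^ r * ((k + 1) * ((k : ℤ) + 1) ^ k + 1) := by ring
        _ ≤ C ^ r * C := by gcongr
        _ = C ^ (r + 1) := (pow_succ _ _).symm
    · have hq0' : (0 : ℝ) < q := by exact_mod_cast hq0
      have hS : 0 ≤ ∑ i, w i * y i ↔ (0 : ℝ) ≤ ((∑ i, p i * y i : ℤ) : ℝ) + ∑ i, w' i * y i := by
        have : ((∑ i, p i * y i : ℤ) : ℝ) + ∑ i, w' i * y i = q / |w i₀| * ∑ i, w i * y i := by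
          push_cast
          rw [← Finset.sum_add_distrib, Finset.mul_sum]
          refine Finset.sum_congr rfl fun i _ => ?_
          simp only [hw', hu]; ring
        rw [this]
        exact (mul_nonneg_iff_of_pos_left (by positivity)).symm
      have hS' : |∑ i, w' i * y i| < 1 := by
        refine (Finset.abs_sum_le_sum_abs _ _).trans_lt ?_
        calc ∑ i, |w' i * y i| ≤ ∑ _i : ι, 1 / ((k : ℝ) + 1) := Finset.sum_le_sum fun i _ => by
              have h1 : |w' i| ≤ 1 / ((k : ℝ) + 1) := by simpa [hw', hp] using hq i
              have h2 : |(y i : ℝ)| ≤ 1 := by exact_mod_cast hy i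
              rw [abs_mul]
              exact (mul_le_of_le_one_right (abs_nonneg _) h2).trans h1
          _ = k / ((k : ℝ) + 1) := by simp [← hk]; ring
          _ < 1 := by rw [div_lt_one (by positivity)]; linarith
      have hV' := abs_sum_mul_le hv' hy
      have hV : ∑ i, (M * p i + v' i) * y i = M * (∑ i, p i * y i) + ∑ i, v' i * y i := by
        rw [Finset.mul_sum, ← Finset.sum_add_distrib]
        exact Finset.sum_congr rfl fun i _ => by ring
      rw [hS, hV]
      have hsg := hs' y hy
      rw [abs_lt] at hS'
      rw [abs_le] at hV'
      set P := ∑ i, p i * y i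
      have hM0 : 0 < M := by positivity
      rcases lt_trichotomy P 0 with hP | hP | hP
      · have : (P : ℝ) ≤ -1 := by exact_mod_cast (by omega : P ≤ -1)
        constructor
        · intro h; linarith
        · intro h; nlinarith
      · simpa [hP] using hsg
      · have : (1 : ℝ) ≤ P := by exact_mod_cast hP
        constructor
        · intro h; nlinarith
        · intro h; linarith

theorem exists_int_weights {ι : Type*} [Fintype ι] (w : ι → ℝ) :
    ∃ v : ι → ℤ, (∀ i, |v i| ≤ 2 ^ (Fintype.card ι + 2) ^ 3) ∧
      ∀ y : ι → ℤ, (∀ i, |y i| ≤ 1) → (0 ≤ ∑ i, w i * y i ↔ 0 ≤ ∑ i, v i * y i) := by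
  obtain ⟨v, hv, h⟩ := exists_int_weights_of_support (Fintype.card ι) w (Finset.card_le_univ _)
  refine ⟨v, fun i => (hv i).trans ?_, h⟩
  set k := Fintype.card ι
  have h2 : (k : ℤ) + 2 ≤ 2 ^ (k + 2) := by exact_mod_cast (Nat.lt_two_pow_self (n := k + 2)).le
  calc (((k : ℤ) + 2) ^ (k + 1)) ^ k ≤ ((2 ^ (k + 2)) ^ (k + 1)) ^ k := by gcongr
    _ = 2 ^ ((k + 2) * (k + 1) * k) := by rw [← pow_mul, ← pow_mul, ← mul_assoc]
    _ ≤ 2 ^ (k + 2) ^ 3 := by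
      refine pow_le_pow_right₀ (by norm_num) ?_
      nlinarith

/-! ### Counting primes and prime divisors -/

theorem card_le_of_primes_dvd {N B : ℕ} (hN : N ≠ 0) (hB : N < 2 ^ B) (P : Finset ℕ)
    (hP : ∀ p ∈ P, p.Prime) (hd : ∀ p ∈ P, p ∣ N) : P.card ≤ B := by
  have h1 : ∏ p ∈ P, p ∣ N :=
    Finset.prod_primes_dvd N (fun p hp => (hP p hp).prime) hd
  have h2 : 2 ^ P.card ≤ ∏ p ∈ P, p := by
    rw [← Finset.prod_const]
    exact Finset.prod_le_prod' fun p hp => (hP p hp).two_le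
  have h3 := (h2.trans (Nat.le_of_dvd (Nat.pos_of_ne_zero hN) h1)).trans_lt hB
  exact ((Nat.pow_lt_pow_iff_right (by norm_num)).1 h3).le

/-- Chebyshev's lower bound at `2 ^ (4 * j)` with `j = ⌈log₂ Q⌉`: the fourth power absorbs the
logarithmic loss, and `2 ^ j ≤ 2 * Q ≤ Q ^ 2` gives the exponent `8`. -/
theorem exists_primes_card {Q : ℕ} (hQ : 2 ≤ Q) :
    ∃ P : Finset ℕ, P.card = Q ∧ ∀ p ∈ P, p.Prime ∧ p ≤ Q ^ 8 := by
  set j := Nat.clog 2 Q with hj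
  have hj1 : 1 ≤ j := Nat.clog_pos (by norm_num) hQ
  have hQj : Q ≤ 2 ^ j := Nat.le_pow_clog (by norm_num) Q
  have hjQ : 2 ^ j ≤ 2 * Q := by
    have := Nat.pow_pred_clog_lt_self (b := 2) (by norm_num) (x := Q) (by omega)
    rw [← hj] at this
    obtain ⟨i, hi⟩ : ∃ i, j = i + 1 := ⟨j - 1, by omega⟩
    rw [hi, Nat.pred_succ] at this
    rw [hi, pow_succ]; omega
  set t := 4 * j with ht
  have hpi : Q ≤ Nat.primeCounting (2 ^ t) := by
    have h := Chebyshev.pi_ge (2 ^ t)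
    have hlog2 : 0 < Real.log 2 := Real.log_pos (by norm_num)
    have htR : (0 : ℝ) < t := by exact_mod_cast (by omega : 0 < t)
    have e1 : Real.log ((2 ^ t : ℕ) : ℝ) = t * Real.log 2 := by push_cast; exact Real.log_pow _ _
    have e2 : Real.log (((2 ^ t : ℕ) : ℝ) + 1) ≤ (t + 1) * Real.log 2 := by
      rw [← Nat.cast_add_one t, ← Real.log_pow]
      refine Real.log_le_log (by positivity) ?_
      push_cast
      have : (1 : ℝ) ≤ 2 ^ t := one_le_pow₀ (by norm_num)
      rw [pow_succ]; linarith
    have h4 : t * Q + t + 1 ≤ 2 ^ t := by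
      have hjj : j < 2 ^ j := Nat.lt_two_pow_self
      have h2j : 2 ≤ 2 ^ j := by simpa using Nat.pow_le_pow_right (n := 2) (by norm_num) hj1
      have : 2 ^ t = (2 ^ j) ^ 4 := by rw [ht, mul_comm, pow_mul]
      rw [this]
      set x := 2 ^ j
      have h5 : t * Q ≤ (4 * (x - 1)) * x := Nat.mul_le_mul (by omega) hQj
      obtain ⟨z, hz⟩ : ∃ z, x = z + 2 := ⟨x - 2, by omega⟩
      have h6 : t ≤ 4 * (x - 1) := by omega
      have : x - 1 = z + 1 := by omega
      rw [this] at h5 h6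
      rw [hz] at h5 ⊢
      nlinarith [Nat.zero_le z, Nat.zero_le (z ^ 2), Nat.zero_le (z ^ 3), Nat.zero_le (z ^ 4)]
    have h4R : (t : ℝ) * Q + t + 1 ≤ 2 ^ t := by exact_mod_cast h4
    have : (Q : ℝ) ≤ Nat.primeCounting (2 ^ t) := by
      refine le_trans ?_ h
      rw [e1, le_div_iff₀ (by positivity)]
      push_cast at e2 ⊢
      nlinarith
    exact_mod_cast this
  have hle : 2 ^ t ≤ Q ^ 8 := by
    calc 2 ^ t = (2 ^ j) ^ 4 := by rw [ht, mul_comm, pow_mul]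
      _ ≤ (2 * Q) ^ 4 := by gcongr
      _ ≤ (Q * Q) ^ 4 := by gcongr
      _ = Q ^ 8 := by ring
  have hcard : Q ≤ (Nat.primesLE (2 ^ t)).card := by
    rw [Nat.primesLE_card_eq_primeCounting]; exact hpi
  obtain ⟨P, hPs, hPc⟩ := Finset.exists_subset_card_eq hcard
  refine ⟨P, hPc, fun p hp => ?_⟩
  have := Nat.mem_primesLE.1 (hPs hp)
  exact ⟨this.2, this.1.trans hle⟩

/-! ### Threshold gates as disjoint sums of exact threshold gates -/

section

variable {X : Type} {G H : Set (X → Bool)}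

theorem mul_add_eq_zero_iff {K a c : ℤ} (hc : |c| ≤ K) : (K + 1) * a + c = 0 ↔ a = 0 ∧ c = 0 := by
  refine ⟨fun h => ?_, fun ⟨h1, h2⟩ => by simp [h1, h2]⟩
  have hc0 : c = 0 := Int.eq_zero_of_abs_lt_dvd (m := K + 1) ⟨-a, by linarith⟩ (by omega)
  have hK : K + 1 ≠ 0 := by have := abs_nonneg c; omega
  exact ⟨(mul_eq_zero.1 (by linarith : (K + 1) * a = 0)).resolve_left hK, hc0⟩

/-- If `D' ≥ 1` then also `D ≥ 1`, and no pair matches. Otherwise `D' = -i` with `i ≥ 0`, and `D ≥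
1` means `δ ≥ 1 + 2 * i`. Then `i ≤ K`, so exactly one listed pair matches. -/
theorem sum_carry_indicator {K : ℕ} {D D' δ : ℤ} (hD : D = 2 * D' + δ) (h0 : 0 ≤ δ) (hK : δ ≤ K) :
    ((if 1 ≤ D then 1 else 0) - (if 1 ≤ D' then 1 else 0) : ℤ) =
      ∑ p ∈ ((Finset.range (K + 1)) ×ˢ (Finset.range (K + 1))).filter
        (fun p : ℕ × ℕ => 1 + 2 * p.1 ≤ p.2),
        if D' + p.1 = 0 ∧ δ - p.2 = 0 then 1 else 0 := by
  by_cases hD' : 1 ≤ D'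
  · rw [if_pos hD', if_pos (by omega), Finset.sum_eq_zero]
    · rfl
    · intro p _
      rw [if_neg (by omega)]
  · have : ∀ p : ℕ × ℕ, (D' + p.1 = 0 ∧ δ - p.2 = 0) ↔ ((-D').toNat, δ.toNat) = p := by
      rintro ⟨i, j⟩
      rw [Prod.mk.injEq]
      dsimp only
      omega
    simp only [this]
    rw [Finset.sum_ite_eq, if_neg hD', sub_zero]
    refine if_congr ?_ rfl rfl
    simp only [Finset.mem_filter, Finset.mem_product, Finset.mem_range]
    omega

theorem sum_eq_sum_ediv_add_emod {ι : Type*} [Fintype ι] (u y : ι → ℤ) (b : ℕ) :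
    ∑ i, u i / 2 ^ b * y i = 2 * ∑ i, u i / 2 ^ (b + 1) * y i + ∑ i, u i / 2 ^ b % 2 * y i := by
  rw [Finset.mul_sum, ← Finset.sum_add_distrib]
  refine Finset.sum_congr rfl fun i _ => ?_
  have h1 : u i / 2 ^ (b + 1) = u i / 2 ^ b / 2 := by
    rw [pow_succ, Int.ediv_ediv_of_nonneg (by positivity)]
  have h2 := Int.mul_ediv_add_emod (u i / 2 ^ b) 2
  rw [h1]
  nth_rewrite 1 [← h2]
  ring

theorem abs_carry_form_le {K M D δ i j : ℤ} (hM : 1 ≤ M) (hD : |D| ≤ K * M) (h0 : 0 ≤ δ)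
    (hK : δ ≤ K) (hi : 0 ≤ i) (hi' : i ≤ K) (hj : 0 ≤ j) (hj' : j ≤ K) :
    |(K + 1) * D + δ + ((K + 1) * i - j)| ≤ (K + 1) * (K + 1) * (2 * M) := by
  have hK1 : 0 ≤ K + 1 := by linarith
  have h1 : |(K + 1) * D| ≤ (K + 1) * (K * M) := by
    rw [abs_mul, abs_of_nonneg hK1]
    exact mul_le_mul_of_nonneg_left hD hK1
  have h2 : (K + 1) * i ≤ (K + 1) * K := mul_le_mul_of_nonneg_left hi' hK1
  have h3 : 0 ≤ (K + 1) * i := mul_nonneg hK1 hi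
  have h4 : (K + 1) * (K + 1) * (1 + M) ≤ (K + 1) * (K + 1) * (2 * M) :=
    mul_le_mul_of_nonneg_left (by linarith) (mul_nonneg hK1 hK1)
  have h5 : (K + 1) * (K * M) + (K + 1) * K + (K + 1) ≤ (K + 1) * (K + 1) * (1 + M) := by
    have : 0 ≤ (K + 1) * M := mul_nonneg hK1 (by linarith)
    linarith
  rw [abs_le] at h1 ⊢
  constructor <;> linarith [h1.1, h1.2]

theorem LinOf.of_option {k : ℕ} {ι : Type} [Fintype ι] {g : ι → X → Bool}
    (hι : Fintype.card ι ≤ k) (hg : ∀ i, g i ∈ G) (u : Option ι → ℤ) :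
    (fun x => ∑ o, u o * o.elim 1 fun i => ind (g i x)) ∈ LinOf k G :=
  ⟨ι, _, g, fun i => u (some i), u none, hι, hg, fun x => by simp [Fintype.sum_option]⟩

theorem ThrOf.exists_bounded {k : ℕ} {f : X → Bool} (h : f ∈ ThrOf k G) :
    ∃ (ι : Type) (_ : Fintype ι) (g : ι → X → Bool) (u : Option ι → ℤ),
      Fintype.card ι ≤ k ∧ (∀ i, g i ∈ G) ∧ (∀ o, |u o| < 2 ^ ((k + 3) ^ 3 + 2)) ∧
      ∀ x, f x = decide (1 ≤ ∑ o, u o * o.elim 1 fun i => ind (g i x)) := by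
  obtain ⟨L, ⟨ι, _, g, v, c, hι, hg, hL⟩, hf⟩ := h
  obtain ⟨v', hv', hs⟩ := exists_int_weights fun o : Option ι => ((o.elim c v : ℤ) : ℝ)
  -- The constant term is raised by one, so that `0 ≤` becomes `1 ≤`. In this form the indicator
  -- dies once all the bits have been shifted out.
  refine ⟨ι, _, g, fun o => v' o + o.elim 1 0, hι, hg, fun o => ?_, fun x => ?_⟩
  · have h1 : |v' o| ≤ 2 ^ (k + 3) ^ 3 := by
      refine (hv' o).trans (pow_le_pow_right₀ (by norm_num) (Nat.pow_le_pow_left ?_ 3))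
      rw [Fintype.card_option]; omega
    have h2 : |(o.elim 1 0 : ℤ)| ≤ 1 := by cases o <;> simp
    have h3 := abs_add_le (v' o) (o.elim 1 0)
    have h4 : (1 : ℤ) ≤ 2 ^ (k + 3) ^ 3 := one_le_pow₀ (by norm_num)
    rw [pow_add]
    linarith
  · have h1 := hs (fun o => o.elim 1 fun i => ind (g i x)) (by
      rintro (_ | i)
      · simp
      · exact abs_le.2 ⟨by have := ind_nonneg (g i x); simp only [Option.elim]; omega,
          ind_le_one (g i x)⟩)
    have h2 : ∑ o : Option ι, ((o.elim c v : ℤ) : ℝ) * ((o.elim 1 fun i => ind (g i x) : ℤ) : ℝ)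
        = (L x : ℝ) := by
      rw [hL, Fintype.sum_option]; push_cast; simp
    rw [h2] at h1
    rw [hf]
    refine decide_eq_decide.2 ?_
    have h3 : (0 : ℝ) ≤ L x ↔ 0 ≤ L x := by exact_mod_cast Iff.rfl
    rw [← h3, h1]
    simp only [add_mul, Finset.sum_add_distrib, Fintype.sum_option, Option.elim]
    simp

/-- A threshold gate is a disjoint sum of polynomially many exact threshold gates. -/
theorem ThrOf.exists_eqOf_sum {k R : ℕ} (hR : 2 ≤ R) (hk : k ≤ R) {f : X → Bool}
    (h : f ∈ ThrOf k G) :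
    ∃ (α : Type) (_ : Fintype α) (E : α → X → Bool), Fintype.card α ≤ R ^ 14 ∧
      (∀ a, E a ∈ EqOf k (R ^ 10) G) ∧ ∀ x, ind (f x) = ∑ a, ind (E a x) := by
  obtain ⟨ι, _, g, u, hι, hg, hu, hf⟩ := ThrOf.exists_bounded h
  set B := (k + 3) ^ 3 + 2 with hB
  set K := k + 1 with hK
  let y : X → Option ι → ℤ := fun x o => o.elim 1 fun i => ind (g i x)
  have hy0 : ∀ x o, 0 ≤ y x o := by
    rintro x (_ | i)
    exacts [zero_le_one, ind_nonneg _]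
  have hy1 : ∀ x o, y x o ≤ 1 := by
    rintro x (_ | i)
    exacts [le_rfl, ind_le_one _]
  have hcard : (Fintype.card (Option ι) : ℤ) ≤ K := by
    rw [Fintype.card_option]; exact_mod_cast Nat.succ_le_succ hι
  -- `D b` is the form with the lowest `b` bits of its coefficients dropped, and `δ b` is the
  -- contribution of bit `b`.
  let D : ℕ → X → ℤ := fun b x => ∑ o, u o / 2 ^ b * y x o
  let δ : ℕ → X → ℤ := fun b x => ∑ o, u o / 2 ^ b % 2 * y x o
  have hDδ : ∀ b x, D b x = 2 * D (b + 1) x + δ b x := fun b x => sum_eq_sum_ediv_add_emod _ _ b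
  have hδ0 : ∀ b x, 0 ≤ δ b x := fun b x => Finset.sum_nonneg fun o _ =>
    mul_nonneg (Int.emod_nonneg _ (by norm_num)) (hy0 x o)
  have hδK : ∀ b x, δ b x ≤ K := fun b x => by
    refine le_trans (Finset.sum_le_sum (g := fun _ => (1 : ℤ)) fun o _ => ?_) (by simpa using hcard)
    have h1 := Int.emod_nonneg (u o / 2 ^ b) (by norm_num : (2 : ℤ) ≠ 0)
    have h2 := Int.emod_lt_of_pos (u o / 2 ^ b) (by norm_num : (0 : ℤ) < 2)
    nlinarith [hy0 x o, hy1 x o]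
  -- Floor division leaves only nonpositive coefficients after `B` bits, so the telescoping sum ends
  -- in `0`.
  have hDB : ∀ x, D B x ≤ 0 := fun x => Finset.sum_nonpos fun o _ => by
    have : u o / 2 ^ B ≤ 0 := by
      have := Int.ediv_lt_of_lt_mul (a := u o) (b := 1) (c := 2 ^ B) (by positivity)
        (by rw [one_mul]; exact (abs_lt.1 (hu o)).2)
      omega
    exact mul_nonpos_of_nonpos_of_nonneg this (hy0 x o)
  have hDabs : ∀ b x, |D b x| ≤ K * 2 ^ B := fun b x => by
    refine (abs_sum_mul_le (M := 2 ^ B) (fun o => ?_) fun o => ?_).trans ?_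
    · have h1 : |u o / 2 ^ b| ≤ |u o| := Int.abs_ediv_le_abs _ _
      exact h1.trans (hu o).le
    · rw [abs_of_nonneg (hy0 x o)]; exact hy1 x o
    · exact mul_le_mul_of_nonneg_right hcard (by positivity)
  let S := ((Finset.range (K + 1)) ×ˢ (Finset.range (K + 1))).filter
        (fun p : ℕ × ℕ => 1 + 2 * p.1 ≤ p.2)
  -- Base `K + 1` merges the two equations `D (b + 1) = -p.1` and `δ b = p.2` into one.
  let L : ℕ → ℕ × ℕ → X → ℤ := fun b p x =>
    ((K : ℤ) + 1) * D (b + 1) x + δ b x + (((K : ℤ) + 1) * p.1 - p.2)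
  have hSK : ∀ p ∈ S, p.1 ≤ K ∧ p.2 ≤ K := fun p hp => by
    simp only [S, Finset.mem_filter, Finset.mem_product, Finset.mem_range] at hp
    omega
  have hiff : ∀ b, ∀ p ∈ S, ∀ x, L b p x = 0 ↔ D (b + 1) x + p.1 = 0 ∧ δ b x - p.2 = 0 := by
    intro b p hp x
    have := hSK p hp
    have h0 := hδ0 b x
    have h1 := hδK b x
    rw [← mul_add_eq_zero_iff (K := K) (abs_le.2 ⟨by omega, by omega⟩)]
    simp only [L]
    rw [show ((K : ℤ) + 1) * D (b + 1) x + δ b x + (((K : ℤ) + 1) * p.1 - p.2)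
      = ((K : ℤ) + 1) * (D (b + 1) x + p.1) + (δ b x - p.2) by ring]
  have hR3 : k + 3 ≤ R ^ 3 := by
    have : 2 ^ 2 ≤ R ^ 2 := Nat.pow_le_pow_left hR 2
    nlinarith
  have hR9 : (k + 3) ^ 3 ≤ R ^ 9 := by
    calc (k + 3) ^ 3 ≤ (R ^ 3) ^ 3 := Nat.pow_le_pow_left hR3 3
      _ = R ^ 9 := by ring
  have e9 : B + 2 * k + 6 ≤ R ^ 10 := by
    have h8 : 2 ^ 8 ≤ R ^ 8 := Nat.pow_le_pow_left hR 8
    have h9 : R ^ 9 = R ^ 8 * R := pow_succ R 8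
    have h10 : R ^ 10 = R ^ 9 * R := pow_succ R 9
    have h11 : R ^ 9 * 2 ≤ R ^ 9 * R := Nat.mul_le_mul_left _ hR
    have h12 : 2 ^ 8 * R ≤ R ^ 8 * R := Nat.mul_le_mul_right _ h8
    omega
  refine ⟨Fin B × S, inferInstance, fun a x => decide (L a.1 a.2 x = 0), ?_, ?_, fun x => ?_⟩
  · have h1 : S.card ≤ (K + 1) * (K + 1) := by
      refine (Finset.card_filter_le _ _).trans ?_
      simp
    rw [Fintype.card_prod, Fintype.card_fin, Fintype.card_coe]
    have h2 : B ≤ R ^ 10 := by omega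
    have h3 : K + 1 ≤ R ^ 2 := by nlinarith
    calc B * S.card ≤ R ^ 10 * (R ^ 2 * R ^ 2) :=
          Nat.mul_le_mul h2 (h1.trans (Nat.mul_le_mul h3 h3))
      _ = R ^ 14 := by ring
  · rintro ⟨b, p, hp⟩
    refine ⟨L b p, ?_, fun x => ?_, fun x => rfl⟩
    · have := LinOf.of_option (G := G) hι hg
        fun o => ((K : ℤ) + 1) * (u o / 2 ^ ((b : ℕ) + 1)) + u o / 2 ^ (b : ℕ) % 2
      have := LinOf.add_const 1 (((K : ℤ) + 1) * p.1 - p.2) this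
      refine Set.mem_of_eq_of_mem (funext fun x => ?_) this
      simp only [L, D, δ, y, Finset.mul_sum, add_mul, Finset.sum_add_distrib, mul_assoc, one_mul]
    · obtain ⟨hp1, hp2⟩ := hSK p hp
      have e1 : (p.1 : ℤ) ≤ K := by exact_mod_cast hp1
      have e2 : (p.2 : ℤ) ≤ K := by exact_mod_cast hp2
      have e4 := hδ0 b x
      have e5 := hδK b x
      have e6 : (K : ℤ) + 1 ≤ 2 ^ (k + 2) := by
        have := (Nat.lt_two_pow_self (n := k + 2)).le
        rw [hK]; exact_mod_cast this
      have e7 : (1 : ℤ) ≤ 2 ^ B := one_le_pow₀ (by norm_num)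
      have e8 : |L b p x| ≤ ((K : ℤ) + 1) * (K + 1) * (2 * 2 ^ B) := by
        exact abs_carry_form_le e7 (hDabs (b + 1) x) e4 e5 (Nat.cast_nonneg _) e1
          (Nat.cast_nonneg _) e2
      refine e8.trans_lt ?_
      calc ((K : ℤ) + 1) * (K + 1) * (2 * 2 ^ B)
          ≤ 2 ^ (k + 2) * 2 ^ (k + 2) * (2 * 2 ^ B) := by gcongr
        _ = 2 ^ (B + 2 * k + 5) := by ring
        _ < 2 ^ R ^ 10 := pow_lt_pow_right₀ (by norm_num) (by omega)
  · have h1 : ind (f x) = ∑ b ∈ Finset.range B,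
        ((if 1 ≤ D b x then 1 else 0) - (if 1 ≤ D (b + 1) x then 1 else 0) : ℤ) := by
      rw [Finset.sum_range_sub' fun b => (if 1 ≤ D b x then 1 else 0 : ℤ), hf, ind_decide,
        if_neg (by have := hDB x; omega : ¬ 1 ≤ D B x), sub_zero]
      simp [D, y]
    rw [h1, Fintype.sum_prod_type, ← Fin.sum_univ_eq_sum_range
      (fun b => ((if 1 ≤ D b x then 1 else 0) - (if 1 ≤ D (b + 1) x then 1 else 0) : ℤ))]
    refine Finset.sum_congr rfl fun b _ => ?_
    rw [sum_carry_indicator (hDδ b x) (hδ0 b x) (hδK b x)]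
    rw [← Finset.sum_coe_sort]
    refine Finset.sum_congr rfl fun p _ => ?_
    rw [ind_decide]
    exact if_congr (hiff b p p.2 x).symm rfl rfl

end

/-! ### Reduction modulo primes, and majorities of thresholds as majorities of majorities -/

section

variable {X : Type} {G H : Set (X → Bool)}

/-- Reduce every coefficient modulo `p`. The weights become small, and a multiple of `p` in the new
range is one of only `k + 1` numbers. -/
theorem LinOf.exists_mod {k : ℕ} {L : X → ℤ} (h : L ∈ LinOf k G) {p : ℕ} (hp : 0 < p) :
    ∃ F, Comb G (p * (k + 1)) F ∧
      ∀ x, 0 ≤ F x ∧ F x < p * (k + 1) ∧ (p : ℤ) ∣ F x - L x := by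
  obtain ⟨ι, _, g, v, c, hι, hg, hL⟩ := h
  have hp' : (0 : ℤ) < p := by exact_mod_cast hp
  have hm0 : ∀ a : ℤ, 0 ≤ a % p := fun a => Int.emod_nonneg a hp'.ne'
  have hmp : ∀ a : ℤ, a % p < p := fun a => Int.emod_lt_of_pos a hp'
  refine ⟨fun x => c % p + ∑ i, v i % p * ind (g i x), ?_, fun x => ⟨?_, ?_, ?_⟩⟩
  · have h1 : ∀ a : ℤ, (a % p).natAbs ≤ p := fun a => by have := hm0 a; have := hmp a; omega
    have h2 := ((Comb.const (G := G) (c % p)).mono (h1 c)).add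
      (Comb.sum Finset.univ fun i _ => ((Comb.ind (hg i)).smul (v i % p)).mono
        (by rw [mul_one]; exact h1 (v i)))
    refine h2.mono ?_
    rw [Finset.card_univ]
    nlinarith
  · exact add_nonneg (hm0 c) (Finset.sum_nonneg fun i _ => mul_nonneg (hm0 _) (ind_nonneg _))
  · have h1 : ∑ i, v i % p * ind (g i x) ≤ ∑ _i : ι, (p : ℤ) := Finset.sum_le_sum fun i _ => by
      nlinarith [hm0 (v i), hmp (v i), ind_nonneg (g i x), ind_le_one (g i x)]
    have h2 : (Fintype.card ι : ℤ) * p ≤ k * p :=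
      mul_le_mul_of_nonneg_right (by exact_mod_cast hι) hp'.le
    simp only [Finset.sum_const, Finset.card_univ, nsmul_eq_mul] at h1
    linarith [hmp c]
  · have : c % p + ∑ i, v i % p * ind (g i x) - L x
        = (c % p - c) + ∑ i, (v i % p - v i) * ind (g i x) := by
      rw [hL]; simp only [sub_mul, Finset.sum_sub_distrib]; ring
    have hd : ∀ a : ℤ, (p : ℤ) ∣ a % p - a := fun a => by
      rw [Int.emod_def]; exact ⟨-(a / p), by ring⟩
    rw [this]
    exact dvd_add (hd c) (Finset.dvd_sum fun i _ => (hd _).mul_right _)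

theorem dvd_indicator_eq_sum {p k : ℕ} (hp : 0 < p) {F L : ℤ} (h0 : 0 ≤ F)
    (hF : F < p * (k + 1)) (hd : (p : ℤ) ∣ F - L) :
    (if (p : ℤ) ∣ L then 1 else 0 : ℤ) =
      ∑ j ∈ Finset.range (k + 1), if F = p * j then 1 else 0 := by
  have hp' : (0 : ℤ) < p := by exact_mod_cast hp
  have hiff : (p : ℤ) ∣ L ↔ (p : ℤ) ∣ F := (dvd_iff_dvd_of_dvd_sub hd).symm
  by_cases h : (p : ℤ) ∣ F
  · obtain ⟨j, rfl⟩ := h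
    have hj : 0 ≤ j := nonneg_of_mul_nonneg_right h0 hp'
    lift j to ℕ using hj
    have hjk : j < k + 1 := by
      have := lt_of_mul_lt_mul_left hF hp'.le
      exact_mod_cast this
    rw [if_pos (hiff.2 (dvd_mul_right _ _)), Finset.sum_eq_single_of_mem j (Finset.mem_range.2 hjk)]
    · simp
    · intro i _ hi
      rw [if_neg]
      intro he
      exact hi (by exact_mod_cast (mul_left_cancel₀ hp'.ne' he).symm)
  · rw [if_neg (fun hL => h (hiff.1 hL)), Finset.sum_eq_zero]
    intro j _
    rw [if_neg]
    rintro rfl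
    exact h (dvd_mul_right _ _)

theorem card_filter_dvd_le {z : ℤ} {B : ℕ} (hz : z ≠ 0) (hB : |z| < 2 ^ B) (P : Finset ℕ)
    (hP : ∀ p ∈ P, p.Prime) : (P.filter fun p : ℕ => (p : ℤ) ∣ z).card ≤ B := by
  refine card_le_of_primes_dvd (N := z.natAbs) (Int.natAbs_ne_zero.2 hz) ?_ _
    (fun p hp => hP p (Finset.mem_filter.1 hp).1)
    (fun p hp => Int.natCast_dvd.1 (Finset.mem_filter.1 hp).2)
  rw [Int.abs_eq_natAbs] at hB
  exact_mod_cast hB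

theorem Comb.dvd_indicator {k M p : ℕ} {L : X → ℤ} (hL : L ∈ LinOf k G) (hp : 0 < p)
    (hpM : p ≤ M) :
    Comb (MajOf (M * (k + 1)) G) ((k + 1) * 3) (fun x => if (p : ℤ) ∣ L x then 1 else 0) := by
  obtain ⟨F, hF, h⟩ := LinOf.exists_mod hL hp
  have hF' := hF.mono (Nat.mul_le_mul_right (k + 1) hpM)
  have h1 : ∀ j : ℕ, (fun x => decide ((p : ℤ) * j ≤ F x)) ∈ MajOf (M * (k + 1)) G :=
    fun j => ⟨F, _, hF', fun _ => rfl⟩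
  have h2 : ∀ j : ℕ, (fun x => decide (-((p : ℤ) * j) ≤ -F x)) ∈ MajOf (M * (k + 1)) G :=
    fun j => ⟨_, _, hF'.neg, fun _ => rfl⟩
  refine (Comb.sum (Finset.range (k + 1)) fun j _ =>
    ((Comb.ind (h1 j)).add (Comb.ind (h2 j))).sub Comb.one).congr (by simp) fun x => ?_
  obtain ⟨h0, hlt, hd⟩ := h x
  rw [dvd_indicator_eq_sum hp h0 hlt hd]
  refine Finset.sum_congr rfl fun j _ => ?_
  simp only [ind_decide]
  split_ifs <;> omega

/-- Averaging over prime moduli approximates an exact threshold gate by majority gates. -/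
theorem EqOf.exists_comb_approx {k B M : ℕ} {f : X → Bool} (h : f ∈ EqOf k B G) (P : Finset ℕ)
    (hP : ∀ p ∈ P, p.Prime ∧ p ≤ M) :
    ∃ Γ, Comb (MajOf (M * (k + 1)) G) (P.card * ((k + 1) * 3)) Γ ∧
      ∀ x, P.card * ind (f x) ≤ Γ x ∧ Γ x ≤ P.card * ind (f x) + B := by
  obtain ⟨L, hL, hB, hf⟩ := h
  refine ⟨_, Comb.sum P fun p hp => Comb.dvd_indicator hL (hP p hp).1.pos (hP p hp).2, fun x => ?_⟩
  rw [hf, ind_decide]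
  -- The sum counts the primes of `P` dividing `L x`: all of them at a zero, at most `B` elsewhere.
  by_cases hx : L x = 0
  · simp [hx]
  · have := card_filter_dvd_le hx (hB x) P fun p hp => (hP p hp).1
    rw [if_neg hx, Finset.sum_boole, mul_zero, zero_add]
    exact ⟨by positivity, by exact_mod_cast this⟩

theorem ThrOf.exists_comb_approx {k R : ℕ} (hR : 2 ≤ R) (hk : k ≤ R) {f : X → Bool}
    (h : f ∈ ThrOf k G) {M : ℕ} (P : Finset ℕ) (hP : ∀ p ∈ P, p.Prime ∧ p ≤ M) :
    ∃ Γ, Comb (MajOf (M * (k + 1)) G) (R ^ 14 * (P.card * ((k + 1) * 3))) Γ ∧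
      ∀ x, |Γ x - P.card * ind (f x)| ≤ R ^ 24 := by
  obtain ⟨α, _, E, hα, hE, hfE⟩ := ThrOf.exists_eqOf_sum hR hk h
  choose Γ hΓ hb using fun a => EqOf.exists_comb_approx (hE a) P hP
  refine ⟨_, (Comb.sum Finset.univ fun a _ => hΓ a).mono (Nat.mul_le_mul_right _ hα), fun x => ?_⟩
  have h1 : ∑ a, (P.card : ℤ) * ind (E a x) = P.card * ind (f x) := by
    rw [hfE, Finset.mul_sum]
  have h2 : (P.card : ℤ) * ind (f x) ≤ ∑ a, Γ a x := by
    rw [← h1]; exact Finset.sum_le_sum fun a _ => (hb a x).1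
  have h3 : ∑ a, Γ a x ≤ P.card * ind (f x) + Fintype.card α * (R : ℤ) ^ 10 := by
    rw [← h1]
    refine (Finset.sum_le_sum fun a _ => (hb a x).2).trans ?_
    rw [Finset.sum_add_distrib]
    simp
  have h4 : (Fintype.card α : ℤ) * (R : ℤ) ^ 10 ≤ R ^ 24 := by
    calc (Fintype.card α : ℤ) * (R : ℤ) ^ 10 ≤ (R : ℤ) ^ 14 * R ^ 10 :=
          mul_le_mul_of_nonneg_right (by exact_mod_cast hα) (by positivity)
      _ = R ^ 24 := by ring
  rw [abs_le]
  constructor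
  · have : (0 : ℤ) ≤ (R : ℤ) ^ 24 := by positivity
    linarith
  · linarith

/-- A majority of threshold gates is a majority of majority gates of polynomial weight. -/
theorem MajOf.thrOf_subset {R : ℕ} (hR : 2 ≤ R) :
    MajOf R (ThrOf R G) ⊆ MajOf (R ^ 218) (MajOf (R ^ 218) G) := by
  rintro f ⟨F, c, hF, hf⟩
  -- A combination of weight `R` accumulates an error of at most `R * R ^ 24`. With `R ^ 27` primes,
  -- this is less than half of the gap `P.card` between consecutive scaled values.
  obtain ⟨P, hPc, hP⟩ := exists_primes_card (Q := R ^ 27)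
    (hR.trans (Nat.le_self_pow (by norm_num) R))
  set M := (R ^ 27) ^ 8 with hM
  set V := R ^ 14 * (P.card * ((R + 1) * 3)) with hV
  have hPV : P.card ≤ V := by
    calc P.card = 1 * (P.card * 1) := by ring
      _ ≤ V := Nat.mul_le_mul (Nat.one_le_pow _ _ (by omega)) (Nat.mul_le_mul_left _ (by omega))
  have key : ∀ {W : ℕ} {F : X → ℤ}, Comb (ThrOf R G) W F →
      ∃ Γ, Comb (MajOf (M * (R + 1)) G) (W * V) Γ ∧
        ∀ x, |Γ x - P.card * F x| ≤ W * (R : ℤ) ^ 24 := by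
    intro W F h
    induction h with
    | zero => exact ⟨_, Comb.zero.mono (by simp), by simp⟩
    | one => exact ⟨_, (Comb.const P.card).mono (by simpa using hPV), fun x => by simp⟩
    | ind hg =>
      obtain ⟨Γ, h1, h2⟩ := ThrOf.exists_comb_approx hR le_rfl hg P hP
      exact ⟨Γ, h1.congr (by simp [hV]) fun _ => rfl, fun x => by simpa using h2 x⟩
    | neg _ ih =>
      obtain ⟨Γ, h1, h2⟩ := ih
      refine ⟨_, h1.neg, fun x => ?_⟩
      rw [← abs_neg]
      refine le_of_eq_of_le (congrArg _ ?_) (h2 x)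
      ring
    | add _ _ ih ih' =>
      obtain ⟨Γ, h1, h2⟩ := ih
      obtain ⟨Γ', h1', h2'⟩ := ih'
      refine ⟨_, (h1.add h1').congr (by ring) fun _ => rfl, fun x => ?_⟩
      refine le_trans (le_of_eq_of_le (congrArg _ ?_) ((abs_add_le _ _).trans
        (add_le_add (h2 x) (h2' x)))) (le_of_eq ?_)
      · ring
      · push_cast; ring
    | mono _ hW ih =>
      obtain ⟨Γ, h1, h2⟩ := ih
      refine ⟨Γ, h1.mono (Nat.mul_le_mul_right _ hW), fun x => (h2 x).trans ?_⟩
      gcongr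
  obtain ⟨Γ, h1, h2⟩ := key hF
  have hR1 : R + 1 ≤ R ^ 2 := by nlinarith
  have hR3 : (R + 1) * 3 ≤ R ^ 4 := by
    have : 2 ^ 2 ≤ R ^ 2 := Nat.pow_le_pow_left hR 2
    calc (R + 1) * 3 ≤ R ^ 2 * R ^ 2 := Nat.mul_le_mul hR1 (by omega)
      _ = R ^ 4 := by ring
  have hRV : R * V ≤ R ^ 218 := by
    rw [hV, hPc]
    calc R * (R ^ 14 * (R ^ 27 * ((R + 1) * 3))) ≤ R * (R ^ 14 * (R ^ 27 * R ^ 4)) := by gcongr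
      _ = R ^ 46 := by ring
      _ ≤ R ^ 218 := Nat.pow_le_pow_right (by omega) (by norm_num)
  have hMR : M * (R + 1) ≤ R ^ 218 := by
    calc M * (R + 1) ≤ M * R ^ 2 := Nat.mul_le_mul_left _ hR1
      _ = R ^ 218 := by rw [hM]; ring
  -- The threshold is lowered by the maximal error, so no accepted input is lost. Inputs with `F x ≤
  -- c - 1` still fall short.
  refine ⟨Γ, P.card * c - R ^ 25, (h1.mono hRV).mono_set (MajOf.mono hMR subset_rfl), fun x => ?_⟩
  rw [hf]
  refine decide_eq_decide.2 ?_
  have h3 := abs_le.1 (h2 x)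
  have h4 : (R : ℤ) * (R : ℤ) ^ 24 = R ^ 25 := by ring
  have h5 : 2 * (R : ℤ) ^ 25 < P.card := by
    rw [hPc]
    have hR' : (2 : ℤ) ≤ R := by exact_mod_cast hR
    push_cast
    have : (0 : ℤ) < R ^ 25 := by positivity
    calc 2 * (R : ℤ) ^ 25 < 4 * R ^ 25 := by linarith
      _ ≤ (R : ℤ) ^ 2 * R ^ 25 := by gcongr; nlinarith
      _ = R ^ 27 := by ring
  rw [h4] at h3
  have hP0 : (0 : ℤ) ≤ P.card := by positivity
  constructor
  · intro h
    have := mul_le_mul_of_nonneg_left h hP0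
    linarith
  · intro h
    by_contra hc
    have h6 : F x ≤ c - 1 := by omega
    have := mul_le_mul_of_nonneg_left h6 hP0
    linarith

end

/-! ### The output gate as a disjoint sum of majorities -/

section

variable {X : Type} {G H : Set (X → Bool)}

/-- Some tuple of `m` primes from a large set certifies non-vanishing of `L` at every point. -/
theorem exists_primes_separating {L : X → ℤ} {B N m : ℕ} (hfin : (Set.range L).Finite)
    (hcard : (Set.range L).ncard ≤ 2 ^ N) (hB : ∀ x, |L x| < 2 ^ B) (P : Finset ℕ)
    (hP : ∀ p ∈ P, p.Prime) (hPm : 2 ^ N * B ^ m < P.card ^ m) :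
    ∃ q : Fin m → ℕ, (∀ j, q j ∈ P) ∧ ∀ x, (∀ j, (q j : ℤ) ∣ L x) → L x = 0 := by
  classical
  set T := hfin.toFinset.filter fun z => z ≠ 0 with hT
  -- A tuple is bad if all its primes divide some nonzero value of `L`. Each value spoils at most `B
  -- ^ m` tuples, so a union bound leaves a good one.
  set bad := T.biUnion fun z =>
    Fintype.piFinset fun _ : Fin m => P.filter fun p : ℕ => (p : ℤ) ∣ z with hbad
  have hTc : T.card ≤ 2 ^ N := by
    refine (Finset.card_filter_le _ _).trans ?_
    rwa [← Set.ncard_eq_toFinset_card _ hfin]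
  have hbc : bad.card ≤ 2 ^ N * B ^ m := by
    refine (Finset.card_biUnion_le_card_mul _ _ (B ^ m) fun z hz => ?_).trans
      (Nat.mul_le_mul_right _ hTc)
    rw [Fintype.card_piFinset_const]
    refine Nat.pow_le_pow_left ?_ _
    obtain ⟨hz1, hz0⟩ := Finset.mem_filter.1 hz
    obtain ⟨x, rfl⟩ := hfin.mem_toFinset.1 hz1
    exact card_filter_dvd_le hz0 (hB x) P hP
  obtain ⟨q, hq, hqb⟩ : ∃ q ∈ Fintype.piFinset (fun _ : Fin m => P), q ∉ bad := by
    by_contra! hc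
    have := Finset.card_le_card (fun q hq => hc q hq : Fintype.piFinset (fun _ : Fin m => P) ⊆ bad)
    rw [Fintype.card_piFinset_const] at this
    omega
  have hqP : ∀ j, q j ∈ P := fun j => Fintype.mem_piFinset.1 hq j
  refine ⟨q, hqP, fun x hx => ?_⟩
  by_contra h0
  refine hqb (Finset.mem_biUnion.2 ⟨L x, ?_, ?_⟩)
  · exact Finset.mem_filter.2 ⟨hfin.mem_toFinset.2 ⟨x, rfl⟩, h0⟩
  · exact Fintype.mem_piFinset.2 fun j => Finset.mem_filter.2 ⟨hqP j, hx j⟩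

/-- A conjunction of exact equalities on small combinations is one majority gate over
pairwise products. -/
theorem mem_majOf_of_forall_eq {V W m : ℕ} (hV : 1 ≤ V)
    (hG : ∀ g ∈ G, Comb H V (fun x => ind (g x)))
    (hGG : ∀ g ∈ G, ∀ g' ∈ G, Comb H V (fun x => ind (g x) * ind (g' x)))
    {F : Fin m → X → ℤ} (hF : ∀ j, Comb G W (F j)) :
    (fun x => decide (∀ j, F j x = 0)) ∈ MajOf (m * (W * W * V)) H := by
  -- The gate tests `-∑ (F j)² ≥ 0`.
  refine ⟨_, 0, (Comb.sum Finset.univ fun j _ => (hF j).mul hV hG hGG (hF j)).neg.mono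
    (by simp), fun x => decide_eq_decide.2 ?_⟩
  rw [le_neg, neg_zero]
  have h0 : ∀ j ∈ Finset.univ, 0 ≤ F j x * F j x := fun j _ => mul_self_nonneg _
  constructor
  · intro h
    simp [h]
  · intro h j
    have := (Finset.sum_eq_zero_iff_of_nonneg h0).1 (le_antisymm h (Finset.sum_nonneg h0)) j
      (Finset.mem_univ _)
    exact mul_self_eq_zero.1 this

/-- For separating primes, `[L = 0] = ∏ j, [q j ∣ L]`, and each factor is the sum over `i ≤ k` of
`[F j = q j * i]`. Expanding the product, `r` records the chosen multiple for every prime. -/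
theorem EqOf.exists_majOf_sum {k B N m M V : ℕ} {f : X → Bool} (h : f ∈ EqOf k B G)
    (hfin : ∀ L ∈ LinOf k G, (Set.range L).Finite ∧ (Set.range L).ncard ≤ 2 ^ N)
    (P : Finset ℕ) (hP : ∀ p ∈ P, p.Prime ∧ p ≤ M) (hPm : 2 ^ N * B ^ m < P.card ^ m)
    (hV : 1 ≤ V) (hG : ∀ g ∈ G, Comb H V (fun x => ind (g x)))
    (hGG : ∀ g ∈ G, ∀ g' ∈ G, Comb H V (fun x => ind (g x) * ind (g' x))) :
    ∃ D : (Fin m → Fin (k + 1)) → X → Bool,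
      (∀ r, D r ∈ MajOf (m * ((2 * M * (k + 1)) * (2 * M * (k + 1)) * V)) H) ∧
      ∀ x, ind (f x) = ∑ r, ind (D r x) := by
  classical
  obtain ⟨L, hL, hB, hf⟩ := h
  obtain ⟨q, hqP, hq⟩ := exists_primes_separating (hfin L hL).1 (hfin L hL).2 hB P
    (fun p hp => (hP p hp).1) hPm
  choose F hF hFx using fun j => LinOf.exists_mod hL (hP _ (hqP j)).1.pos
  refine ⟨fun r x => decide (∀ j, F j x - (q j : ℤ) * (r j : ℕ) = 0), fun r => ?_, fun x => ?_⟩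
  · refine mem_majOf_of_forall_eq hV hG hGG fun j => ?_
    refine ((hF j).sub (Comb.const _)).mono ?_
    have h1 : q j ≤ M := (hP _ (hqP j)).2
    have h2 : q j * (k + 1) ≤ M * (k + 1) := Nat.mul_le_mul_right _ h1
    have h3 : q j * (r j : ℕ) ≤ M * (k + 1) := Nat.mul_le_mul h1 (r j).2.le
    have h4 : ((q j : ℤ) * (r j : ℕ)).natAbs = q j * (r j : ℕ) := by
      rw [← Nat.cast_mul, Int.natAbs_natCast]
    rw [h4]
    linarith
  · have h1 : ind (f x) = ∏ j, (if (q j : ℤ) ∣ L x then 1 else 0 : ℤ) := by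
      rw [Finset.prod_ite_zero, hf, ind_decide]
      simp only [Finset.mem_univ, true_imp_iff, Finset.prod_const_one]
      exact if_congr ⟨fun h j => by simp [h], hq x⟩ rfl rfl
    have h2 : ∀ j, (if (q j : ℤ) ∣ L x then 1 else 0 : ℤ)
        = ∑ i : Fin (k + 1), if F j x - (q j : ℤ) * (i : ℕ) = 0 then 1 else 0 := fun j => by
      obtain ⟨a, b, c⟩ := hFx j x
      rw [dvd_indicator_eq_sum (hP _ (hqP j)).1.pos a b c, ← Fin.sum_univ_eq_sum_range
        (fun i => if F j x = (q j : ℤ) * i then (1 : ℤ) else 0)]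
      simp only [sub_eq_zero]
    rw [h1, Finset.prod_congr rfl fun j _ => h2 j, Finset.prod_univ_sum, Fintype.piFinset_univ]
    refine Finset.sum_congr rfl fun r _ => ?_
    rw [Finset.prod_ite_zero, ind_decide]
    simp

/-- Write both gates as sums of exact gates, multiply out, merge each conjunction into one exact
gate, and return to thresholds. The products still read `G` directly, so the depth does not grow. -/
theorem ThrOf.comb_mul {s R : ℕ} (hR : 2 ≤ R) (hs : s ≤ R) {g g' : X → Bool}
    (hg : g ∈ ThrOf s G) (hg' : g' ∈ ThrOf s G) :
    Comb (ThrOf (s + s) G) (R ^ 30) (fun x => ind (g x) * ind (g' x)) := by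
  obtain ⟨α, _, E, hα, hE, hgE⟩ := ThrOf.exists_eqOf_sum hR hs hg
  obtain ⟨α', _, E', hα', hE', hgE'⟩ := ThrOf.exists_eqOf_sum hR hs hg'
  refine ((Comb.sum (Finset.univ : Finset (α × α')) fun a _ =>
    EqOf.comb_thrOf (EqOf.and (hE a.1) (hE' a.2))).mono ?_).congr rfl fun x => ?_
  · rw [Finset.card_univ, Fintype.card_prod]
    have h3 : 3 ≤ R ^ 2 := by nlinarith
    calc Fintype.card α * Fintype.card α' * 3 ≤ R ^ 14 * R ^ 14 * R ^ 2 := by gcongr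
      _ = R ^ 30 := by ring
  · rw [hgE, hgE', Finset.sum_mul_sum, Fintype.sum_prod_type]
    simp only [ind_and]

theorem ThrOf.exists_majOf_sum {k s R N m : ℕ} {f : X → Bool} (hs : 2 ≤ s) (hk : k ≤ s)
    (hsR : s ≤ R) (hm : 1 ≤ m) (hmR : m ≤ R) (hN : 2 ^ N ≤ R ^ m)
    (hfin : ∀ L ∈ LinOf k (ThrOf s G), (Set.range L).Finite ∧ (Set.range L).ncard ≤ 2 ^ N)
    (h : f ∈ ThrOf k (ThrOf s G)) :
    ∃ (α : Type) (_ : Fintype α) (D : α → X → Bool), Fintype.card α ≤ s ^ 14 * (k + 1) ^ m ∧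
      (∀ a, D a ∈ MajOf (R ^ 229) (ThrOf (R ^ 229) G)) ∧ ∀ x, ind (f x) = ∑ a, ind (D a x) := by
  obtain ⟨α, _, E, hα, hE, hfE⟩ := ThrOf.exists_eqOf_sum hs hk h
  have hR : 2 ≤ R := hs.trans hsR
  obtain ⟨P, hPc, hP⟩ := exists_primes_card (Q := R ^ 12)
    (hR.trans (Nat.le_self_pow (by norm_num) R))
  -- The exact gates have `s ^ 10` bits. One factor `R` per prime pays for the `2 ^ N` values, and
  -- another makes the inequality strict.
  have hPm : 2 ^ N * (s ^ 10) ^ m < P.card ^ m := by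
    rw [hPc]
    calc 2 ^ N * (s ^ 10) ^ m ≤ R ^ m * (R ^ 10) ^ m := by gcongr
      _ = (R ^ 11) ^ m := by rw [← mul_pow]; ring
      _ < (R ^ 12) ^ m := Nat.pow_lt_pow_left
          (Nat.pow_lt_pow_right (by omega) (by norm_num)) (by omega)
  have hGG : ∀ g ∈ ThrOf s G, ∀ g' ∈ ThrOf s G,
      Comb (ThrOf (s + s) G) (R ^ 30) (fun x => ind (g x) * ind (g' x)) :=
    fun g hg g' hg' => ThrOf.comb_mul hR hsR hg hg'
  -- An indicator is its own square.
  have hG : ∀ g ∈ ThrOf s G, Comb (ThrOf (s + s) G) (R ^ 30) (fun x => ind (g x)) :=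
    fun g hg => (hGG g hg g hg).congr rfl fun x => by cases g x <;> simp [ind]
  choose D hD hDx using fun a => EqOf.exists_majOf_sum (hE a) hfin P hP hPm
    (Nat.one_le_pow _ _ (by omega)) hG hGG
  refine ⟨α × (Fin m → Fin (k + 1)), inferInstance, fun a => D a.1 a.2, ?_, fun a => ?_, fun x => ?_⟩
  · rw [Fintype.card_prod, Fintype.card_fun, Fintype.card_fin, Fintype.card_fin]
    exact Nat.mul_le_mul_right _ hα
  · refine MajOf.mono ?_ (ThrOf.mono ?_ subset_rfl) (hD a.1 a.2)
    · have h1 : 2 * (R ^ 12) ^ 8 * (k + 1) ≤ R ^ 99 := by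
        have : k + 1 ≤ R ^ 2 := by nlinarith
        calc 2 * (R ^ 12) ^ 8 * (k + 1) ≤ R * (R ^ 12) ^ 8 * R ^ 2 := by gcongr
          _ = R ^ 99 := by ring
      calc m * (2 * (R ^ 12) ^ 8 * (k + 1) * (2 * (R ^ 12) ^ 8 * (k + 1)) * R ^ 30)
          ≤ R * (R ^ 99 * R ^ 99 * R ^ 30) := by gcongr
        _ = R ^ 229 := by ring
    · calc s + s ≤ R ^ 2 := by nlinarith
        _ ≤ R ^ 229 := Nat.pow_le_pow_right (by omega) (by norm_num)
  · rw [hfE, Fintype.sum_prod_type]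
    exact Finset.sum_congr rfl fun a _ => hDx a x

end

/-! ### Formulas of bounded depth and their translation from and to circuits -/

/-- The functions computed by literals. -/
def litFns (n : ℕ) : Set ((Fin n → Bool) → Bool) := Set.range fun l x => Lit.eval x l

/-- Functions of threshold formulas of the given depth with gates of fan-in at most `S`. -/
def ThrIter (n S : ℕ) : ℕ → Set ((Fin n → Bool) → Bool)
  | 0 => litFns n
  | d + 1 => ThrOf S (ThrIter n S d)

/-- Functions of majority formulas of the given depth with gates of total weight at most `S`. -/
def MajIter (n S : ℕ) : ℕ → Set ((Fin n → Bool) → Bool)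
  | 0 => litFns n
  | d + 1 => MajOf S (MajIter n S d)

theorem litFns_complClosed (n : ℕ) : ComplClosed (litFns n) := by
  rintro _ ⟨⟨i, b⟩, rfl⟩
  refine ⟨(i, !b), funext fun x => ?_⟩
  simp only [Lit.eval]
  cases x i <;> cases b <;> rfl

theorem MajIter.complClosed (n S : ℕ) : ∀ d, ComplClosed (MajIter n S d)
  | 0 => litFns_complClosed n
  | _ + 1 => MajOf.complClosed _ _

theorem ThrIter.mono {n S S' : ℕ} (h : S ≤ S') : ∀ d, ThrIter n S d ⊆ ThrIter n S' d
  | 0 => subset_rfl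
  | d + 1 => ThrOf.mono h (ThrIter.mono h d)

/-- A majority of depth-`d` threshold formulas is a majority formula of depth `d + 1` and
polynomial size. -/
theorem majOf_thrIter_subset (d : ℕ) :
    ∃ K : ℕ, 1 ≤ K ∧ ∀ n R : ℕ, 2 ≤ R → MajOf R (ThrIter n R d) ⊆ MajIter n (R ^ K) (d + 1) := by
  induction d with
  | zero => exact ⟨1, le_rfl, fun n R _ => MajOf.mono (by simp) subset_rfl⟩
  | succ d ih =>
    obtain ⟨K, hK, h⟩ := ih
    refine ⟨218 * K, by omega, fun n R hR => (MajOf.thrOf_subset hR).trans (MajOf.mono ?_ ?_)⟩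
    · exact Nat.pow_le_pow_right (by omega) (by omega)
    · have hR' : R ≤ R ^ 218 := Nat.le_self_pow (by norm_num) R
      rw [pow_mul]
      exact (MajOf.mono le_rfl (ThrIter.mono hR' d)).trans (h n (R ^ 218) (hR.trans hR'))

theorem ThrGate.eval_mem_thrOf {X α : Type} {G : Set (X → Bool)} (g : ThrGate α)
    (v : X → α → Bool) (hv : ∀ a, (fun x => v x a) ∈ G) {S : ℕ} (hS : g.fanIn ≤ S) :
    (fun x => g.eval (v x)) ∈ ThrOf S G := by
  obtain ⟨u, -, hs⟩ := exists_int_weights fun o : Option (Fin g.fanIn) =>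
    (o.elim (-g.threshold) g.weight : ℝ)
  refine ⟨_, ⟨Fin g.fanIn, inferInstance, fun i x => v x (g.source i), fun i => u (some i),
    u none, by simpa using hS, fun i => hv _, fun x => rfl⟩, fun x => ?_⟩
  have h1 := hs (fun o => o.elim 1 fun i => ind (v x (g.source i))) (by
    rintro (_ | i)
    · simp
    · exact abs_le.2 ⟨by have := ind_nonneg (v x (g.source i)); simp only [Option.elim]; omega,
        ind_le_one _⟩)
  simp only [Fintype.sum_option, Option.elim, Int.cast_one, mul_one] at h1
  refine decide_eq_decide.2 (Iff.trans ?_ h1)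
  have : ∀ i, g.weight i * ((ind (v x (g.source i)) : ℤ) : ℝ)
      = if v x (g.source i) then g.weight i else 0 := fun i => by
    cases v x (g.source i) <;> simp [ind]
  simp only [this]
  constructor <;> intro h <;> linarith

theorem ThrLayers.eval_mem_thrIter {n S : ℕ} : ∀ {d w : ℕ} (C : ThrLayers n d w),
    C.size ≤ S → ∀ j, (fun x => C.eval x j) ∈ ThrIter n S d
  | _, _, .bottom g, hS, j => by
    refine ThrGate.eval_mem_thrOf (g j) (fun x => Lit.eval x)
      (fun l => (⟨l, rfl⟩ : _ ∈ litFns _)) ?_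
    have : 1 + (g j).fanIn ≤ ∑ j, (1 + (g j).fanIn) :=
      Finset.single_le_sum (f := fun j => 1 + (g j).fanIn) (fun _ _ => Nat.zero_le _)
        (Finset.mem_univ j)
    rw [ThrLayers.size] at hS
    omega
  | _, _, .layer C g, hS, j => by
    rw [ThrLayers.size] at hS
    refine ThrGate.eval_mem_thrOf (g j) (fun x => C.eval x)
      (fun i => ThrLayers.eval_mem_thrIter C (by omega) i) ?_
    have : 1 + (g j).fanIn ≤ ∑ j, (1 + (g j).fanIn) :=
      Finset.single_le_sum (f := fun j => 1 + (g j).fanIn) (fun _ _ => Nat.zero_le _)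
        (Finset.mem_univ j)
    omega

theorem MajOf.exists_fin {X : Type} {G : Set (X → Bool)} (hG : ComplClosed G) {W : ℕ}
    {f : X → Bool} (h : f ∈ MajOf W G) :
    ∃ (k : ℕ) (g : Fin k → X → Bool) (t : ℤ), k ≤ W ∧ (∀ i, g i ∈ G) ∧
      ∀ x, f x = decide (t ≤ ∑ i, ind (g i x)) := by
  obtain ⟨F, c, hF, hf⟩ := h
  obtain ⟨l, c', hl, hlG, hFl⟩ := hF.exists_list hG
  refine ⟨l.length, l.get, c - c', hl, fun i => hlG _ (l.get_mem i), fun x => ?_⟩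
  have : (l.map fun g => ind (g x)).sum = ∑ i, ind (l.get i x) := by
    rw [← List.sum_ofFn]
    congr 1
    exact (List.ofFn_get _).symm.trans (by simp)
  rw [hf, hFl, this]
  exact decide_eq_decide.2 (by omega)

/-- The majority gate with the given sources and integer threshold. -/
def majGate {α : Type} {k : ℕ} (s : Fin k → α) (t : ℤ) : ThrGate α := ⟨k, s, fun _ => 1, t⟩

theorem majGate_eval {α : Type} {k : ℕ} (s : Fin k → α) (t : ℤ) (v : α → Bool) :
    (majGate s t).eval v = decide (t ≤ ∑ i, ind (v (s i))) := by
  rw [ThrGate.eval]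
  refine decide_eq_decide.2 ?_
  have : (∑ i : Fin k, if v (s i) then (1 : ℝ) else 0) = ((∑ i, ind (v (s i)) : ℤ) : ℝ) := by
    simp [ind]
  change (t : ℝ) ≤ (∑ i : Fin k, if v (s i) then (1 : ℝ) else 0) ↔ _
  rw [this]
  exact Int.cast_le

/-- Families of majority formulas are computed by layered majority circuits. -/
theorem exists_layers_of_majIter {n S : ℕ} (d : ℕ) :
    ∀ {w : ℕ} (f : Fin w → (Fin n → Bool) → Bool), (∀ j, f j ∈ MajIter n S (d + 1)) →
      ∃ C : ThrLayers n (d + 1) w, C.IsMaj ∧ (∀ x j, C.eval x j = f j x) ∧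
        C.size ≤ w * ((d + 1) * (1 + S) ^ (d + 1)) := by
  induction d with
  | zero =>
    intro w f hf
    choose k g t hk hg hfg using fun j => MajOf.exists_fin (litFns_complClosed n) (hf j)
    choose l hl using hg
    refine ⟨.bottom fun j => majGate (l j) (t j), fun j i => rfl, fun x j => ?_, ?_⟩
    · simp only [ThrLayers.eval]
      rw [majGate_eval, hfg]
      simp only [← hl]
    · rw [ThrLayers.size]
      refine (Finset.sum_le_card_nsmul _ _ (1 + S) fun j _ => ?_).trans (by simp)
      exact Nat.add_le_add_left (hk j) 1
  | succ d ih =>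
    intro w f hf
    choose k g t hk hg hfg using fun j => MajOf.exists_fin (MajIter.complClosed n S (d + 1)) (hf j)
    -- Every wire gets its own copy of the gate it reads. Sharing is lost, but for constant depth
    -- the size stays polynomial in `S`.
    let e : (Σ j : Fin w, Fin (k j)) ≃ Fin (∑ j, k j) := finSigmaFinEquiv
    obtain ⟨C, hC, hCe, hCs⟩ := ih (fun a => g (e.symm a).1 (e.symm a).2) fun a => hg _ _
    refine ⟨.layer C fun j => majGate (fun i => e ⟨j, i⟩) (t j), ⟨hC, fun j i => rfl⟩,
      fun x j => ?_, ?_⟩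
    · simp only [ThrLayers.eval]
      rw [majGate_eval, hfg]
      have he : ∀ i, C.eval x (e ⟨j, i⟩) = g j i x := fun i => by
        rw [hCe, Equiv.symm_apply_apply]
      simp only [he]
    · have h1 : ∑ j, k j ≤ w * S :=
        (Finset.sum_le_card_nsmul _ _ S fun j _ => hk j).trans (by simp)
      have h2 : ∑ j : Fin w, (1 + k j) ≤ w * (1 + S) :=
        (Finset.sum_le_card_nsmul _ _ (1 + S) fun j _ => Nat.add_le_add_left (hk j) 1).trans
          (by simp)
      set T := (1 + S) ^ (d + 1) with hT
      have hT1 : 1 ≤ T := Nat.one_le_pow _ _ (by omega)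
      calc C.size + ∑ j : Fin w, (1 + k j)
          ≤ (w * S) * ((d + 1) * T) + w * (1 + S) :=
            Nat.add_le_add (hCs.trans (Nat.mul_le_mul_right _ h1)) h2
        _ ≤ w * (((d + 1) * (T * (1 + S))) + T * (1 + S)) := by
            have : w * (1 + S) ≤ w * (T * (1 + S)) :=
              Nat.mul_le_mul_left _ (Nat.le_mul_of_pos_left _ hT1)
            nlinarith [Nat.zero_le (w * (d + 1) * T)]
        _ = w * ((d + 1 + 1) * (1 + S) ^ (d + 1 + 1)) := by rw [pow_succ, ← hT]; ring

theorem exists_hltCircuit_of_majIter {n S d : ℕ} {f : (Fin n → Bool) → Bool}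
    (hf : f ∈ MajIter n S (d + 1)) :
    ∃ C : HLTCircuit n (d + 1), (∀ x, LTCircuit.fn C.1 x = f x) ∧
      ThrLayers.size C.1 ≤ (d + 1) * (1 + S) ^ (d + 1) := by
  obtain ⟨C, hC, hCe, hCs⟩ := exists_layers_of_majIter d (fun _ : Fin 1 => f) fun _ => hf
  exact ⟨⟨C, hC⟩, fun x => hCe x 0, by simpa using hCs⟩

/-- A disjoint sum of majority formulas yields a disjoint OR of majority circuits. -/
theorem exists_disjOrHLT {n S d : ℕ} {f : (Fin n → Bool) → Bool} {α : Type} [Fintype α]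
    {D : α → (Fin n → Bool) → Bool} (hD : ∀ a, D a ∈ MajIter n S (d + 1))
    (hf : ∀ x, ind (f x) = ∑ a, ind (D a x)) :
    ∃ E : DisjOrHLT n (d + 1), (∀ x, E.fn x = f x) ∧ E.fanIn = Fintype.card α ∧
      ∀ i, ThrLayers.size (E.sub i).1 ≤ (d + 1) * (1 + S) ^ (d + 1) := by
  classical
  choose C hC hCs using fun a => exists_hltCircuit_of_majIter (hD a)
  let e := (Fintype.equivFin α).symm
  -- Disjointness is automatic: the indicators sum to an indicator, so no two of them are `1`
  -- together.
  have hdisj : ∀ x a b, D a x = true → D b x = true → a = b := by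
    intro x a b ha hb
    by_contra hne
    have h1 : ∑ c ∈ {a, b}, ind (D c x) ≤ ∑ c, ind (D c x) :=
      Finset.sum_le_sum_of_subset_of_nonneg (Finset.subset_univ _) fun _ _ _ => ind_nonneg _
    rw [Finset.sum_pair hne, ← hf, ha, hb] at h1
    have := ind_le_one (f x)
    simp only [ind, if_true] at h1 this
    omega
  refine ⟨⟨Fintype.card α, fun i => C (e i), fun x i j hi hj => ?_⟩, fun x => ?_, rfl,
    fun i => hCs _⟩
  · rw [hC] at hi hj
    exact e.injective (hdisj x _ _ hi hj)
  · rw [DisjOrHLT.fn, Bool.eq_iff_iff, decide_eq_true_iff]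
    simp only [hC]
    constructor
    · rintro ⟨i, hi⟩
      have h1 := Finset.single_le_sum (f := fun a => ind (D a x)) (fun _ _ => ind_nonneg _)
        (Finset.mem_univ (e i))
      rw [← hf, ind_eq_one.2 hi] at h1
      exact ind_eq_one.1 (le_antisymm (ind_le_one _) h1)
    · intro hx
      by_contra! hc
      have h0 : ∀ a, ind (D a x) = 0 := fun a => by
        have := hc (e.symm a)
        rw [Equiv.apply_symm_apply] at this
        simp [ind, this]
      have := hf x
      rw [Finset.sum_eq_zero fun a _ => h0 a, ind_eq_one.2 hx] at this
      exact one_ne_zero this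

/-! ### Assembly and choice of parameters -/

theorem LTCircuit.exists_disjOrHLT (e : ℕ) :
    ∃ K : ℕ, ∀ (n s R N m : ℕ) (C : LTCircuit n (e + 2)), 2 ≤ s → s ≤ R → 1 ≤ m → m ≤ R →
      2 ^ N ≤ R ^ m → (N = n ∨ N = s) → ThrLayers.size C ≤ s →
      ∃ D : DisjOrHLT n (e + 2), (∀ x, D.fn x = C.fn x) ∧ D.fanIn ≤ s ^ 14 * s ^ m ∧
        ∀ i, ThrLayers.size (D.sub i).1 ≤ (e + 2) * (1 + R ^ K) ^ (e + 2) := by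
  obtain ⟨K, -, hK⟩ := majOf_thrIter_subset (e + 1)
  refine ⟨229 * K, fun n s R N m C hs hsR hm hmR hN hNs hC => ?_⟩
  cases C with
  | layer C' g =>
    rw [ThrLayers.size] at hC
    simp only [Fin.sum_univ_one] at hC
    -- The output gate itself counts in the size. This turns `(k + 1) ^ m` into `s ^ m` with no
    -- extra constant factor in the exponent.
    have hk : (g 0).fanIn + 1 ≤ s := by omega
    have hmem : LTCircuit.fn (.layer C' g) ∈ ThrOf (g 0).fanIn (ThrOf s (ThrIter n s e)) :=
      ThrGate.eval_mem_thrOf (g 0) (fun x => C'.eval x)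
        (fun i => ThrLayers.eval_mem_thrIter C' (by omega) i) le_rfl
    obtain ⟨α, _, D, hα, hD, hDx⟩ := ThrOf.exists_majOf_sum (N := N) hs (by omega) hsR hm hmR hN
      (fun L hL => by
        refine ⟨(LinOf.ncard_range_le hL).1, ?_⟩
        -- The values of `L` are counted either by the `n` input bits or by the wires of the output
        -- gate.
        rcases hNs with rfl | rfl
        · rw [← Set.image_univ]
          refine (Set.ncard_image_le Set.finite_univ).trans ?_
          rw [Set.ncard_univ, Nat.card_eq_fintype_card]
          simp
        · exact (LinOf.ncard_range_le hL).2.trans (Nat.pow_le_pow_right (by norm_num) (by omega)))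
      hmem
    have hR : 2 ≤ R := hs.trans hsR
    have hR1 : R ≤ R ^ 229 := Nat.le_self_pow (by norm_num) R
    have hDm : ∀ a, D a ∈ MajIter n (R ^ (229 * K)) (e + 1 + 1) := fun a => by
      rw [pow_mul]
      exact hK n (R ^ 229) (hR.trans hR1) (MajOf.mono le_rfl
        (ThrOf.mono le_rfl (ThrIter.mono (hsR.trans hR1) e)) (hD a))
    obtain ⟨E, hE, hEα, hEs⟩ := _root_.exists_disjOrHLT hDm hDx
    refine ⟨E, hE, hEα.trans_le (hα.trans ?_), hEs⟩
    exact Nat.mul_le_mul_left _ (Nat.pow_le_pow_left hk m)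

/-- The output gate uses up the whole size, so it has no wires and computes a constant. -/
theorem LTCircuit.exists_disjOrHLT_of_size_le_one {n e : ℕ} (C : LTCircuit n (e + 2))
    (hC : ThrLayers.size C ≤ 1) :
    ∃ D : DisjOrHLT n (e + 2), (∀ x, D.fn x = C.fn x) ∧ D.fanIn = 1 ∧
      ∀ i, ThrLayers.size (D.sub i).1 ≤ e + 2 := by
  cases C with
  | layer C' g =>
    rw [ThrLayers.size] at hC
    simp only [Fin.sum_univ_one] at hC
    have hf : LTCircuit.fn (.layer C' g) ∈ MajIter n 0 (e + 1 + 1) := by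
      obtain ⟨L, ⟨ι, _, g', v, c, hι, -, hL⟩, hfL⟩ :=
        ThrGate.eval_mem_thrOf (G := Set.univ) (S := 0) (g 0) (fun x => C'.eval x)
          (fun i => Set.mem_univ _) (by omega)
      have : IsEmpty ι := Fintype.card_eq_zero_iff.1 (by omega)
      refine ⟨_, -c, Comb.zero, fun x => (hfL x).trans (decide_eq_decide.2 ?_)⟩
      rw [hL]
      simp
    obtain ⟨E, hE, hEα, hEs⟩ := _root_.exists_disjOrHLT (α := Unit) (f := LTCircuit.fn (.layer C' g))
      (fun _ => hf) fun x => by simp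
    exact ⟨E, hE, by simpa using hEα, by simpa using hEs⟩

/-- The number of blocks and the weight bound attached to the parameters `s`, `n` and `ε`. -/
theorem exists_block_parameters {s n : ℕ} {ε : ℝ} (hs : 2 ≤ s) (hn : 1 ≤ n)
    (hε : Real.logb 2 s / n < ε) (hε1 : ε < 1) :
    ∃ R m N : ℕ, s ≤ R ∧ 1 ≤ m ∧ m ≤ R ∧ 2 ^ N ≤ R ^ m ∧ (N = n ∨ N = s) ∧
      (R : ℝ) ≤ (s : ℝ) ^ (2 / ε) ∧ ((s : ℝ) ^ 14 * (s : ℝ) ^ m) ≤ (2 : ℝ) ^ (16 * ε * n) := by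
  set l := Real.logb 2 s with hl
  have hsR : (2 : ℝ) ≤ s := by exact_mod_cast hs
  have hs0 : (0 : ℝ) < s := by linarith
  have hn0 : (0 : ℝ) < n := by exact_mod_cast hn
  have hsl : (2 : ℝ) ^ l = s := Real.rpow_logb (by norm_num) (by norm_num) hs0
  have hl1 : 1 ≤ l := by
    rw [hl, Real.le_logb_iff_rpow_le (by norm_num) hs0, Real.rpow_one]; exact hsR
  have hl0 : 0 < l := by linarith
  have hε0 : 0 < ε := (div_pos hl0 hn0).trans hε
  have hlεn : l ≤ ε * n := ((div_lt_iff₀ hn0).1 hε).le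
  have hε' : 1 ≤ 1 / ε := by rw [le_div_iff₀ hε0]; linarith
  set N := min n s with hN
  have hN1 : 1 ≤ N := by omega
  have hN1R : (1 : ℝ) ≤ N := by exact_mod_cast hN1
  -- The least `m` with `(s ^ (1 / ε)) ^ m ≥ 2 ^ N`. Rounding up costs at most one factor `s`, which
  -- `l ≤ ε * n` absorbs.
  set m := ⌈ε * N / l⌉₊ with hm
  set R := ⌈(s : ℝ) ^ (1 / ε)⌉₊ with hR
  have hsR1 : (s : ℝ) ≤ (s : ℝ) ^ (1 / ε) := by
    nth_rewrite 1 [← Real.rpow_one (s : ℝ)]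
    exact Real.rpow_le_rpow_of_exponent_le (by linarith) hε'
  have hRge : (s : ℝ) ^ (1 / ε) ≤ R := Nat.le_ceil _
  have hsR' : s ≤ R := by exact_mod_cast hsR1.trans hRge
  have hms : m ≤ s := by
    rw [hm, Nat.ceil_le, div_le_iff₀ hl0]
    have h1 : (N : ℝ) ≤ s := by exact_mod_cast min_le_right n s
    nlinarith
  refine ⟨R, m, N, hsR', ?_, hms.trans hsR', ?_, ?_, ?_, ?_⟩
  · exact Nat.one_le_ceil_iff.2 (by positivity)
  · have h1 : (N : ℝ) ≤ l * (1 / ε) * m := by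
      have := Nat.le_ceil (ε * N / l)
      rw [← hm, div_le_iff₀ hl0] at this
      rw [mul_one_div, div_mul_eq_mul_div, le_div_iff₀ hε0]
      linarith
    have h2 : (2 : ℝ) ^ N ≤ (R : ℝ) ^ m := by
      calc (2 : ℝ) ^ N = (2 : ℝ) ^ (N : ℝ) := (Real.rpow_natCast _ _).symm
        _ ≤ (2 : ℝ) ^ (l * (1 / ε) * m) := Real.rpow_le_rpow_of_exponent_le (by norm_num) h1
        _ = ((s : ℝ) ^ (1 / ε)) ^ m := by
          rw [Real.rpow_mul_natCast (by norm_num), Real.rpow_mul (by norm_num), hsl]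
        _ ≤ (R : ℝ) ^ m := pow_le_pow_left₀ (by positivity) hRge m
    exact_mod_cast h2
  · rcases min_choice n s with h | h
    · exact Or.inl h
    · exact Or.inr h
  · have h1 : (R : ℝ) ≤ (s : ℝ) ^ (1 / ε) + 1 := (Nat.ceil_lt_add_one (by positivity)).le
    have h2 : (s : ℝ) ^ (2 / ε) = (s : ℝ) ^ (1 / ε) * (s : ℝ) ^ (1 / ε) := by
      rw [← Real.rpow_add hs0]; congr 1; ring
    rw [h2]
    nlinarith
  · have h1 : l * m ≤ 2 * (ε * n) := by
      have h3 := (Nat.ceil_lt_add_one (by positivity : 0 ≤ ε * N / l)).le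
      have h4 : l * m ≤ l * (ε * N / l + 1) := mul_le_mul_of_nonneg_left h3 hl0.le
      rw [mul_add, mul_div_cancel₀ _ hl0.ne'] at h4
      have h5 : (N : ℝ) ≤ n := by exact_mod_cast min_le_left n s
      nlinarith
    have h6 : ∀ a : ℕ, (s : ℝ) ^ a = (2 : ℝ) ^ (l * a) := fun a => by
      rw [Real.rpow_mul_natCast (by norm_num), hsl]
    rw [h6, h6, ← Real.rpow_add (by norm_num)]
    refine Real.rpow_le_rpow_of_exponent_le (by norm_num) ?_
    push_cast
    linarith

theorem mainTheorem7 (d : ℕ) (hd : 2 ≤ d) :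
    ∃ c : ℝ, 0 < c ∧
      ∀ s : ℕ → ℕ, (fun n : ℕ => Real.logb 2 (s n)) =o[atTop] (fun n : ℕ => (n : ℝ)) →
        ∀ n : ℕ, 1 ≤ n →
          ∀ ε : ℝ, Real.logb 2 (s n) / n < ε → ε < 1 →
            ∀ C : LTCircuit n d, ThrLayers.size C ≤ s n →
              ∃ D : DisjOrHLT n d,
                (∀ x : Fin n → Bool, D.fn x = C.fn x) ∧
                (D.fanIn : ℝ) ≤ (2 : ℝ) ^ (c * ε * n) ∧
                ∀ i : Fin D.fanIn,
                  (ThrLayers.size (D.sub i).1 : ℝ) ≤ c * (s n : ℝ) ^ (c / ε) := by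
  obtain ⟨e, rfl⟩ : ∃ e, d = e + 2 := ⟨d - 2, by omega⟩
  obtain ⟨K, hK⟩ := LTCircuit.exists_disjOrHLT e
  -- The summands serve the fan-in exponent, the leading factor of the size and the exponent of the
  -- size.
  set c : ℕ := 16 + (e + 2) + 2 * ((K + 1) * (e + 2)) with hc
  refine ⟨c, by positivity, fun s _ n hn ε hε hε1 C hC => ?_⟩
  have hn0 : (0 : ℝ) < n := by exact_mod_cast hn
  have hd_le : ((e + 2 : ℕ) : ℝ) ≤ c := by exact_mod_cast (by omega : e + 2 ≤ c)
  -- Here `s n` must be `1`, since the output gate already counts. Then `s n ^ (c / ε) = 1`, so a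
  -- size bound depending on the depth alone is needed.
  rcases Nat.lt_or_ge (s n) 2 with hs | hs
  · have hlog : Real.logb 2 (s n) = 0 := by
      have : s n = 0 ∨ s n = 1 := by omega
      rcases this with h | h <;> simp [h]
    have hs1 : s n = 1 := by
      cases C with
      | layer C' g =>
        rw [ThrLayers.size] at hC
        simp only [Fin.sum_univ_one] at hC
        omega
    have hε0 : 0 < ε := by simpa [hlog] using hε
    obtain ⟨D, hD, hDf, hDs⟩ := LTCircuit.exists_disjOrHLT_of_size_le_one C (by omega)
    refine ⟨D, hD, ?_, fun i => ?_⟩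
    · rw [hDf, Nat.cast_one]
      exact Real.one_le_rpow (by norm_num) (by positivity)
    · rw [hs1, Nat.cast_one, Real.one_rpow, mul_one]
      exact (Nat.cast_le.2 (hDs i)).trans hd_le
  · obtain ⟨R, m, N, hsR, hm, hmR, hN, hNs, hRs, hfan⟩ := exists_block_parameters hs hn hε hε1
    obtain ⟨D, hD, hDf, hDs⟩ := hK n (s n) R N m C hs hsR hm hmR hN hNs hC
    have hsR' : (2 : ℝ) ≤ s n := by exact_mod_cast hs
    have hε0 : 0 < ε := by
      have : 0 ≤ Real.logb 2 (s n) := Real.logb_nonneg (by norm_num) (by linarith)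
      exact (div_nonneg this hn0.le).trans_lt hε
    refine ⟨D, hD, ?_, fun i => ?_⟩
    · calc (D.fanIn : ℝ) ≤ (s n : ℝ) ^ 14 * (s n : ℝ) ^ m := by exact_mod_cast hDf
        _ ≤ (2 : ℝ) ^ (16 * ε * n) := hfan
        _ ≤ (2 : ℝ) ^ (c * ε * n) := by
          refine Real.rpow_le_rpow_of_exponent_le (by norm_num) ?_
          have : (16 : ℝ) ≤ c := by exact_mod_cast (by omega : 16 ≤ c)
          gcongr
    · have hR2 : 2 ≤ R := hs.trans hsR
      have h1 : 1 + R ^ K ≤ R ^ (K + 1) := by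
        have : 1 ≤ R ^ K := Nat.one_le_pow _ _ (by omega)
        rw [pow_succ]; nlinarith
      have h2 : ThrLayers.size (D.sub i).1 ≤ (e + 2) * R ^ ((K + 1) * (e + 2)) :=
        (hDs i).trans (Nat.mul_le_mul_left _ (by
          rw [pow_mul]; exact Nat.pow_le_pow_left h1 _))
      have h3 : (R : ℝ) ^ ((K + 1) * (e + 2)) ≤ (s n : ℝ) ^ (c / ε) := by
        calc (R : ℝ) ^ ((K + 1) * (e + 2)) ≤ ((s n : ℝ) ^ (2 / ε)) ^ ((K + 1) * (e + 2)) :=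
              pow_le_pow_left₀ (Nat.cast_nonneg _) hRs _
          _ = (s n : ℝ) ^ (2 / ε * ((K + 1) * (e + 2) : ℕ)) := by
              rw [Real.rpow_mul_natCast (by positivity)]
          _ ≤ (s n : ℝ) ^ (c / ε) := by
              refine Real.rpow_le_rpow_of_exponent_le (by linarith) ?_
              rw [div_mul_eq_mul_div]
              gcongr
              exact_mod_cast (by omega : 2 * ((K + 1) * (e + 2)) ≤ c)
      calc (ThrLayers.size (D.sub i).1 : ℝ) ≤ ((e + 2 : ℕ) : ℝ) * (R : ℝ) ^ ((K + 1) * (e + 2)) := by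
            exact_mod_cast h2
        _ ≤ c * (s n : ℝ) ^ (c / ε) :=
            mul_le_mul hd_le h3 (by positivity) (Nat.cast_nonneg _)
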